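/- Let $X=(x_0,x_1)$ with $x_0<x_1$, and let $\alpha:X\to\mathbb R$ be Lebesgue integrable. For $\sigma\in\mathbb C$ put $$E^X_\alpha(\sigma)=1+\sum_{j\ge1}\ \int_{x_0<s_1<\cdots<s_j<x_1}e^{2i\sigma\kappa(s_1,\dots,s_j)}\prod_{\nu=1}^j\alpha(s_\nu)\,ds_1\cdots ds_j ,$$ where $\kappa(s_1,\dots,s_j)=(s_j-s_{j-1})+\cdots+(s_2-s_1)$ for even $j$ and $\kappa(s_1,\dots,s_j)=(s_j-s_{j-1})+\cdots+(s_3-s_2)+(s_1-x_0)$ for odd $j$, and let $\mathrm{Cosh}^X_\alpha=\tfrac12(E^X_\alpha+E^X_{-\alpha})$, $\mathrm{Sech}^X_\alpha=1/\mathrm{Cosh}^X_\alpha$. A function $F$ on the upper half plane is called outer if there are $c\in\mathbb C$ with $|c|=1$ and a real-valued $k$ on $\mathbb R$ with $\int_{\mathbb R}|k(s)|\frac{ds}{1+s^2}<\infty$ such that $F(\sigma)=c\exp\Bigl(\frac1{i\pi}\int_{\mathbb R}\frac{1+s\sigma}{s-\sigma}k(s)\frac{ds}{1+s^2}\Bigr)$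 for $\operatorname{Im}\sigma>0$. **(1)** $\mathrm{Cosh}^X_\alpha$ has no zeros in $\operatorname{Im}\sigma\ge0$. The function $\mathrm{Sech}^X_\alpha$ is holomorphic in a neighbourhood of every point of the closed upper half plane $\operatorname{Im}\sigma\ge0$, bounded on $\operatorname{Im}\sigma\ge0$, and outer. **(2)** The function $\log|\mathrm{Sech}^X_\alpha(s)|/(1+s^2)$ is integrable over $\mathbb R$, and $$\mathrm{Sech}^X_\alpha(\sigma)=\exp\left(\frac1{i\pi}\int_{\mathbb R}\frac{1+s\sigma}{s-\sigma}\,\log\bigl|\mathrm{Sech}^X_\alpha(s)\bigr|\,\frac{ds}{1+s^2}\right)\qquad(\operatorname{Im}\sigma>0).$$ For real $\sigma$ the formula holds in the sense of boundary values: the right-hand side, evaluated at points of the open upper half plane, tends to $\mathrm{Sech}^X_\alpha(\sigma)$ as these points tend to $\sigma$. **(3)** For $\sigma\in\mathbb R$, let $(a,b)$ be an absolutely continuous solution on $[x_0,x_1]$ of $a'+i\sigma a+\alpha b=0$, $b'+\alpha a-i\sigma b=0$ with $b(x_0)=1$ and $a(x_1)=0$ (a wave of frequency $\sigma$ and unit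 amplitude enters at $x_0$ from the left, and nothing enters at $x_1$ from the right). Such a solution exists, and the transmitted amplitude $T(\sigma):=b(x_1)$ is uniquely determined, namely $T(\sigma)=e^{i(x_1-x_0)\sigma}\,\mathrm{Sech}^X_\alpha(\sigma)$. There is exactly one tempered distribution $\tau=\tau^X_\alpha$ on $\mathbb R$ (the transmission data of the layer) whose Fourier transform $\hat\tau(\sigma)=\int\tau(t)e^{i\sigma t}\,dt$ is the function $T$; its power spectrum is $|\hat\tau(\sigma)|^2=|\mathrm{Sech}^X_\alpha(\sigma)|^2$. For intervals of known thickness, the transmission data are determined by their power spectrum: if $Y=(y_0,y_1)$ with $y_1-y_0=x_1-x_0$, $\beta:Y\to\mathbb R$ is integrable, and $|\widehat{\tau^X_\alpha}|^2=|\widehat{\tau^Y_\beta}|^2$ almost everywhere on $\mathbb R$, then $\tau^X_\alpha=\tau^Y_\beta$. -/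

import Mathlib

open MeasureTheory Filter Topology Set
open scoped FourierTransform SchwartzMap

noncomputable section

namespace HarmonicExp

/-- The open ordered simplex `x₀ < s₁ < ⋯ < s_j < x₁` in `ℝ^j`. -/
def orderedSimplex (x₀ x₁ : ℝ) (j : ℕ) : Set (Fin j → ℝ) :=
  {s | StrictMono s ∧ ∀ i, s i ∈ Ioo x₀ x₁}

/-- `κ(s₁,…,s_j)`, that is `(s_j - s_{j-1}) + ⋯ + (s₂ - s₁)` for even `j`, and
`(s_j - s_{j-1}) + ⋯ + (s₃ - s₂) + (s₁ - x₀)` for odd `j`. The indices `i : Fin j` start at `0`,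
so the last coordinate `i = j - 1` has sign `+`, and the signs alternate. -/
def kappa (x₀ : ℝ) (j : ℕ) (s : Fin j → ℝ) : ℝ :=
  (∑ i : Fin j, (-1 : ℝ) ^ (j + 1 + (i : ℕ)) * s i) - if Odd j then x₀ else 0

/-- The `j`-th summand of the harmonic exponential,
`∫_{x₀ < s₁ < ⋯ < s_j < x₁} e^{2iσκ(s)} α(s₁) ⋯ α(s_j) ds`. -/
def hexpTerm (x₀ x₁ : ℝ) (α : ℝ → ℝ) (j : ℕ) (σ : ℂ) : ℂ :=
  ∫ s in orderedSimplex x₀ x₁ j,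
    Complex.exp (2 * Complex.I * σ * (kappa x₀ j s : ℂ)) * ((∏ i, α (s i) : ℝ) : ℂ)

/-- The harmonic exponential `E^X_α(σ)`, `X = (x₀, x₁)`. -/
def hexp (x₀ x₁ : ℝ) (α : ℝ → ℝ) (σ : ℂ) : ℂ :=
  1 + ∑' j : ℕ, hexpTerm x₀ x₁ α (j + 1) σ

/-- `Cosh^X_α = (E^X_α + E^X_{-α}) / 2`. -/
def Cosh (x₀ x₁ : ℝ) (α : ℝ → ℝ) (σ : ℂ) : ℂ :=
  (hexp x₀ x₁ α σ + hexp x₀ x₁ (-α) σ) / 2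

/-- `Sech^X_α = 1 / Cosh^X_α`. -/
def Sech (x₀ x₁ : ℝ) (α : ℝ → ℝ) (σ : ℂ) : ℂ :=
  1 / Cosh x₀ x₁ α σ

/-- `exp ( (1/(iπ)) ∫_ℝ (1 + sσ)/(s - σ) · k(s) ds/(1+s²) )`. -/
def outerExp (k : ℝ → ℝ) (σ : ℂ) : ℂ :=
  Complex.exp (1 / (Complex.I * Real.pi) *
    ∫ s : ℝ, (1 + (s : ℂ) * σ) / ((s : ℂ) - σ) * (k s : ℂ) / (1 + (s : ℂ) ^ 2))

/-- Outer functions on the upper half plane: `F(σ) = c · exp((1/(iπ)) ∫ (1+sσ)/(s-σ) k(s) ds/(1+s²))`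
for `Im σ > 0`, with `|c| = 1` and `k` real-valued such that `∫ |k(s)| ds/(1+s²) < ∞`. -/
def IsOuter (F : ℂ → ℂ) : Prop :=
  ∃ (c : ℂ) (k : ℝ → ℝ), ‖c‖ = 1 ∧ Integrable (fun s : ℝ => k s / (1 + s ^ 2)) ∧
    ∀ σ : ℂ, 0 < σ.im → F σ = c * outerExp k σ

/-- `(a, b)` is an absolutely continuous solution on `[x₀, x₁]` of the first order system
`a' + iσ a + α b = 0`, `b' + α a - iσ b = 0`, written in integrated form. Here `a` and `b` are the
left-moving and the right-moving component of the wave field at frequency `σ`. -/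
def IsWaveSolution (x₀ x₁ : ℝ) (α : ℝ → ℝ) (σ : ℝ) (a b : ℝ → ℂ) : Prop :=
  ContinuousOn a (Icc x₀ x₁) ∧ ContinuousOn b (Icc x₀ x₁) ∧
  ∀ x ∈ Icc x₀ x₁,
    a x = a x₀ - (∫ y in x₀..x, (Complex.I * σ * a y + α y * b y)) ∧
    b x = b x₀ - (∫ y in x₀..x, (α y * a y - Complex.I * σ * b y))

/-- `T` is the amplitude transmitted across `(x₀, x₁)` at frequency `σ`: a wave of amplitude `1`
enters at `x₀` from the left, nothing enters at `x₁` from the right, and the right-moving wave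
that leaves at `x₁` is `T`. -/
def IsTransmittedAmplitude (x₀ x₁ : ℝ) (α : ℝ → ℝ) (σ : ℝ) (T : ℂ) : Prop :=
  ∃ a b : ℝ → ℂ, IsWaveSolution x₀ x₁ α σ a b ∧ b x₀ = 1 ∧ a x₁ = 0 ∧ b x₁ = T

/-- The Fourier transform `τ̂(σ) = ∫ τ(t) e^{iσt} dt` of the tempered distribution `τ` is the
function `f`. Since Mathlib's inverse transform is `(𝓕⁻ τ)(ξ) = ∫ τ(t) e^{2πiξt} dt = τ̂(2πξ)`, this
says that `𝓕⁻ τ` is the function `ξ ↦ f (2πξ)`. -/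
def HasFourierTransform (τ : 𝓢'(ℝ, ℂ)) (f : ℝ → ℂ) : Prop :=
  ∀ φ : 𝓢(ℝ, ℂ), Integrable (fun ξ : ℝ => φ ξ * f (2 * Real.pi * ξ)) ∧
    (𝓕⁻ τ) φ = ∫ ξ : ℝ, φ ξ * f (2 * Real.pi * ξ)

/-- `τ` is the (time domain) transmission data of the layer: the signal received at `x₁` when a
Dirac pulse is sent into the layer at `x₀` at time `0`. Its Fourier transform at each real
frequency is the amplitude transmitted at that frequency. -/
def IsTransmissionData (x₀ x₁ : ℝ) (α : ℝ → ℝ) (τ : 𝓢'(ℝ, ℂ)) : Prop :=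
  ∃ T : ℝ → ℂ, (∀ σ : ℝ, IsTransmittedAmplitude x₀ x₁ α σ (T σ)) ∧ HasFourierTransform τ T

/-- `P` is a version of the power spectrum `|τ̂|²` of `τ`, which is defined up to null sets. -/
def IsPowerSpectrum (τ : 𝓢'(ℝ, ℂ)) (P : ℝ → ℝ) : Prop :=
  ∃ f : ℝ → ℂ, HasFourierTransform τ f ∧ ∀ᵐ σ : ℝ, P σ = ‖f σ‖ ^ 2

end HarmonicExp

end

noncomputable section

namespace HarmonicExp

/-! Fix the right endpoint `b` and let the left endpoint `x` vary. Separating the smallest variable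
in the simplex integrals (`hexpTerm_succ`) shows that the even part c and the odd part g of the
harmonic exponential of (x, b) satisfy c' = -αg and g' = -αc - 2iσg almost everywhere, with c = 1
and g = 0 at `b`; moreover c is `Cosh`. For Im σ ≥ 0 the quantity |c|² - |g|² is nonincreasing in x,
hence |c|² ≥ 1 + |g|² (`one_add_norm_oddPart_sq_le`). So `Cosh` has no zeros, |`Sech`| ≤ 1 and |g/c|
≤ 1.

Since (log c)' = -αg/c, the integral -∫ αg/c is a logarithm of `Sech` (`exp_logSech`). It is bounded
by ∫|α|, holomorphic in the open half plane and continuous up to the real line. Such a function is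
recovered from its real boundary values up to an imaginary constant, by a Schwarz formula that comes
from Cauchy's theorem (`schwarz_integral_formula`); the constant vanishes because the logarithm is
real at σ = i. Exponentiating gives the outer representation with c = 1 and k = log|`Sech`|.

For real σ, a multiple of e^{iσx}(g, c) is the required wave, and conservation of |b|² - |a|² makes
the transmitted amplitude unique. As a bounded continuous function it is the Fourier transform of
exactly one tempered distribution. Equal power spectra force equal |`Sech`| almost everywhere, hence
everywhere on ℝ by continuity, hence equal outer functions and equal boundary values; the remaining
phase depends on the thickness alone. -/

/-! ### Simplex integrals and their recursion. -/

lemma measurableSet_orderedSimplex (x b : ℝ) (j : ℕ) : MeasurableSet (orderedSimplex x b j) := by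
  have h : orderedSimplex x b j =
      (⋂ i, ⋂ k, ⋂ (_ : i < k), {s : Fin j → ℝ | s i < s k}) ∩ ⋂ i, {s | s i ∈ Ioo x b} := by
    ext s
    simp [orderedSimplex, StrictMono]
  rw [h]
  refine (MeasurableSet.iInter fun i => MeasurableSet.iInter fun k => MeasurableSet.iInter
    fun _ => measurableSet_lt (measurable_pi_apply i) (measurable_pi_apply k)).inter
    (MeasurableSet.iInter fun i => (measurable_pi_apply i) measurableSet_Ioo)

lemma continuous_kappa (x : ℝ) (j : ℕ) : Continuous (kappa x j) := by
  unfold kappa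
  fun_prop

lemma exists_abs_kappa_le (x b : ℝ) (j : ℕ) :
    ∃ K : ℝ, 0 ≤ K ∧ ∀ s ∈ orderedSimplex x b j, |kappa x j s| ≤ K := by
  obtain ⟨K, hK⟩ := (isCompact_univ_pi fun _ : Fin j => isCompact_Icc (a := x) (b := b)
    ).exists_bound_of_continuousOn (continuous_kappa x j).continuousOn
  refine ⟨max K 0, le_max_right _ _, fun s hs => le_max_of_le_left ?_⟩
  exact hK s fun i _ => Ioo_subset_Icc_self (hs.2 i)

lemma norm_exp_two_I_mul (σ : ℂ) (r : ℝ) :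
    ‖Complex.exp (2 * Complex.I * σ * (r : ℂ))‖ = Real.exp (-(2 * σ.im * r)) := by
  rw [Complex.norm_exp]
  congr 1
  simp [Complex.mul_re, Complex.mul_im]

lemma norm_exp_two_I_mul_le (σ : ℂ) (r : ℝ) :
    ‖Complex.exp (2 * Complex.I * σ * (r : ℂ))‖ ≤ Real.exp (2 * |σ.im| * |r|) := by
  rw [norm_exp_two_I_mul, Real.exp_le_exp]
  calc -(2 * σ.im * r) ≤ |2 * σ.im * r| := neg_le_abs _
    _ = _ := by rw [abs_mul, abs_mul, abs_two]

lemma aestronglyMeasurable_simplex_integrand {α : ℝ → ℝ} (hα : Integrable α) (x : ℝ) (j : ℕ)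
    (σ : ℂ) (μ : Measure (Fin j → ℝ)) (hμ : μ ≪ volume) :
    AEStronglyMeasurable (fun s : Fin j → ℝ =>
      Complex.exp (2 * Complex.I * σ * (kappa x j s : ℂ)) * ((∏ i, α (s i) : ℝ) : ℂ)) μ := by
  have h1 : Integrable (fun s : Fin j → ℝ => ∏ i, α (s i)) :=
    Integrable.fintype_prod (f := fun _ => α) fun _ => hα
  have h2 : Continuous fun s => Complex.exp (2 * Complex.I * σ * (kappa x j s : ℂ)) := by
    have := continuous_kappa x j
    fun_prop
  exact (h2.aestronglyMeasurable.mul h1.ofReal.aestronglyMeasurable).mono_ac hμ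

lemma integrableOn_simplex_integrand {α : ℝ → ℝ} (hα : Integrable α) (x b : ℝ) (j : ℕ) (σ : ℂ) :
    IntegrableOn (fun s : Fin j → ℝ =>
      Complex.exp (2 * Complex.I * σ * (kappa x j s : ℂ)) * ((∏ i, α (s i) : ℝ) : ℂ))
      (orderedSimplex x b j) := by
  have h1 : Integrable (fun s : Fin j → ℝ => ∏ i, α (s i)) :=
    Integrable.fintype_prod (f := fun _ => α) fun _ => hα
  obtain ⟨K, -, hK⟩ := exists_abs_kappa_le x b j
  refine Integrable.mono' (g := fun s => Real.exp (2 * |σ.im| * K) * ‖∏ i, α (s i)‖)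
    (h1.norm.const_mul _).integrableOn
    (aestronglyMeasurable_simplex_integrand hα x j σ _ Measure.restrict_le_self.absolutelyContinuous)
    ?_
  filter_upwards [ae_restrict_mem (measurableSet_orderedSimplex x b j)] with s hs
  rw [norm_mul, Complex.norm_real]
  gcongr
  refine (norm_exp_two_I_mul_le _ _).trans ?_
  gcongr
  exact hK s hs

lemma hexpTerm_zero (x b : ℝ) (α : ℝ → ℝ) (σ : ℂ) : hexpTerm x b α 0 σ = 1 := by
  have : orderedSimplex x b 0 = univ := by
    ext s
    simp [orderedSimplex, StrictMono]
  simp [hexpTerm, this, kappa, Measure.real, volume_pi]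

lemma cons_mem_orderedSimplex (x b t : ℝ) (j : ℕ) (s : Fin j → ℝ) :
    (Fin.cons t s : Fin (j + 1) → ℝ) ∈ orderedSimplex x b (j + 1) ↔
      t ∈ Ioo x b ∧ s ∈ orderedSimplex t b j := by
  constructor
  · rintro ⟨h1, h2⟩
    refine ⟨by simpa using h2 0, fun i k hik => ?_, fun i => ⟨?_, ?_⟩⟩
    · simpa using h1 (Fin.succ_lt_succ_iff.2 hik)
    · simpa using h1 (Fin.succ_pos i)
    · simpa using (h2 i.succ).2
  · rintro ⟨ht, h1, h2⟩
    refine ⟨fun i k => ?_, fun i => ?_⟩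
    · refine Fin.cases ?_ (fun i => ?_) i <;> refine Fin.cases ?_ (fun k => ?_) k
      · simp
      · intro _
        simpa using (h2 k).1
      · intro h
        exact absurd h (by simp)
      · intro h
        simpa using h1 (Fin.succ_lt_succ_iff.1 h)
    · refine Fin.cases (by simpa using ht) (fun i => ?_) i
      simpa using And.intro (ht.1.trans (h2 i).1) (h2 i).2

/-- The weight with which the first gap enters `kappa` on a simplex of dimension `j + 1`. -/
def gapWeight (j : ℕ) : ℝ := if Even j then 1 else 0

/-- The first of the j + 1 coordinates carries the sign (-1)^j. For even j it is paired with -x as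
the first gap; for odd j it is the base point -t of the remaining simplex. -/
lemma kappa_cons (x t : ℝ) (j : ℕ) (s : Fin j → ℝ) :
    kappa x (j + 1) (Fin.cons t s) = gapWeight j * (t - x) + kappa t j s := by
  unfold kappa gapWeight
  rw [Fin.sum_univ_succ]
  have h : ∀ i : Fin j, (-1 : ℝ) ^ (j + 1 + 1 + ((i.succ : Fin (j + 1)) : ℕ)) = (-1) ^ (j + 1 + (i : ℕ)) := by
    intro i
    rw [Fin.val_succ, show j + 1 + 1 + ((i : ℕ) + 1) = (j + 1 + i) + 2 by ring, pow_add]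
    simp
  simp only [Fin.cons_zero, Fin.cons_succ, h, Fin.val_zero]
  rcases Nat.even_or_odd j with hj | hj
  · have h1 : ¬ Odd j := Nat.not_odd_iff_even.2 hj
    have h2 : Odd (j + 1) := hj.add_one
    have h3 : Even (j + 1 + 1 + 0) := h2.add_one
    rw [if_pos h2, if_pos hj, if_neg h1, h3.neg_one_pow]
    ring
  · have h1 : ¬ Even j := Nat.not_even_iff_odd.2 hj
    have h2 : ¬ Odd (j + 1) := Nat.not_odd_iff_even.2 hj.add_one
    have h3 : Odd (j + 1 + 1 + 0) := hj.add_one.add_one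
    rw [if_neg h2, if_neg h1, if_pos hj, h3.neg_one_pow]
    ring

/-- Fubini in the smallest variable t: the others range over the simplex of (t, b), and `kappa_cons`
splits the exponential. The differential equations in x come from this recursion. -/
lemma hexpTerm_succ {α : ℝ → ℝ} (hα : Integrable α) (x b : ℝ) (j : ℕ) (σ : ℂ) :
    hexpTerm x b α (j + 1) σ = ∫ t in Ioo x b,
      α t * Complex.exp (2 * Complex.I * σ * (gapWeight j * (t - x) : ℝ)) * hexpTerm t b α j σ := by
  set f : (Fin (j + 1) → ℝ) → ℂ := (orderedSimplex x b (j + 1)).indicator fun s =>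
    Complex.exp (2 * Complex.I * σ * (kappa x (j + 1) s : ℂ)) * ((∏ i, α (s i) : ℝ) : ℂ) with hf
  have hfi : Integrable f :=
    (integrable_indicator_iff (measurableSet_orderedSimplex _ _ _)).2
      (integrableOn_simplex_integrand hα x b (j + 1) σ)
  set e := MeasurableEquiv.piFinSuccAbove (fun _ : Fin (j + 1) => ℝ) 0
  have he : MeasurePreserving e.symm :=
    (volume_preserving_piFinSuccAbove (fun _ : Fin (j + 1) => ℝ) 0).symm e
  have hes : ∀ p : ℝ × (Fin j → ℝ), e.symm p = (Fin.cons p.1 p.2 : Fin (j + 1) → ℝ) := by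
    intro p
    simp [e, MeasurableEquiv.piFinSuccAbove, Fin.insertNthEquiv]
  have hfi' : Integrable (fun p : ℝ × (Fin j → ℝ) => f (Fin.cons p.1 p.2)) := by
    have := (he.integrable_comp_emb e.symm.measurableEmbedding (g := f)).2 hfi
    refine this.congr (Eventually.of_forall fun p => ?_)
    simp only [Function.comp, hes]
  have h1 : hexpTerm x b α (j + 1) σ = ∫ p : ℝ × (Fin j → ℝ), f (Fin.cons p.1 p.2) := by
    rw [hexpTerm, ← integral_indicator (measurableSet_orderedSimplex _ _ _), ← hf,
      ← he.integral_comp e.symm.measurableEmbedding]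
    simp only [hes]
  rw [h1, Measure.volume_eq_prod, integral_prod _ hfi', ← integral_indicator measurableSet_Ioo]
  congr 1
  ext t
  by_cases ht : t ∈ Ioo x b
  · rw [indicator_of_mem ht, hexpTerm, ← integral_const_mul,
      ← integral_indicator (measurableSet_orderedSimplex _ _ _)]
    congr 1
    ext s
    by_cases hs : s ∈ orderedSimplex t b j
    · rw [hf, indicator_of_mem ((cons_mem_orderedSimplex x b t j s).2 ⟨ht, hs⟩),
        indicator_of_mem hs, kappa_cons, Fin.prod_univ_succ]
      simp only [Fin.cons_zero, Fin.cons_succ]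
      push_cast
      rw [mul_add, Complex.exp_add]
      ring
    · rw [hf, indicator_of_notMem (fun h => hs ((cons_mem_orderedSimplex x b t j s).1 h).2),
        indicator_of_notMem hs]
  · rw [indicator_of_notMem ht]
    refine integral_eq_zero_of_ae (Eventually.of_forall fun s => ?_)
    exact indicator_of_notMem (fun h => ht ((cons_mem_orderedSimplex x b t j s).1 h).1) _

/-- Allows α to be replaced by its extension by zero, so that integrability on all of ℝ may be
assumed. -/
lemma hexpTerm_congr {x b : ℝ} {α β : ℝ → ℝ} (h : EqOn α β (Ioo x b)) (j : ℕ) (σ : ℂ) :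
    hexpTerm x b α j σ = hexpTerm x b β j σ := by
  refine setIntegral_congr_fun (measurableSet_orderedSimplex _ _ _) fun s hs => ?_
  simp only [Finset.prod_congr rfl fun i _ => h (hs.2 i)]

lemma hexpTerm_neg (x b : ℝ) (α : ℝ → ℝ) (j : ℕ) (σ : ℂ) :
    hexpTerm x b (-α) j σ = (-1) ^ j * hexpTerm x b α j σ := by
  rw [hexpTerm, hexpTerm, ← integral_const_mul]
  congr 1
  ext s
  simp only [Pi.neg_apply, Finset.prod_neg, Finset.card_univ, Fintype.card_fin]
  push_cast
  ring

/-- At σ = i the exponent 2iσκ is the real number -2κ. This reality later fixes the unimodular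
constant of the outer function. -/
lemma hexpTerm_I_im (x b : ℝ) (α : ℝ → ℝ) (j : ℕ) : (hexpTerm x b α j Complex.I).im = 0 := by
  have : hexpTerm x b α j Complex.I = ((∫ s in orderedSimplex x b j,
      Real.exp (-2 * kappa x j s) * ∏ i, α (s i) : ℝ) : ℂ) := by
    rw [hexpTerm, ← integral_complex_ofReal]
    congr 1
    ext s
    push_cast
    congr 2
    linear_combination (2 * (kappa x j s : ℂ)) * Complex.I_mul_I
  rw [this, Complex.ofReal_im]

/-! ### Holomorphic dependence on the frequency. -/

/-- Holomorphic dependence on a parameter of an integral with a uniform integrable bound. -/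
lemma differentiableOn_integral_of_norm_le {X : Type*} [MeasurableSpace X] {μ : Measure X}
    {U : Set ℂ} (hU : IsOpen U) {F : ℂ → X → ℂ} {bound : X → ℝ}
    (hm : ∀ σ ∈ U, AEStronglyMeasurable (F σ) μ)
    (hd : ∀ᵐ a ∂μ, DifferentiableOn ℂ (fun σ => F σ a) U)
    (hb : ∀ᵐ a ∂μ, ∀ σ ∈ U, ‖F σ a‖ ≤ bound a) (hi : Integrable bound μ) :
    DifferentiableOn ℂ (fun σ => ∫ a, F σ a ∂μ) U := by
  intro z hz
  obtain ⟨r, hr, hrU⟩ := Metric.isOpen_iff.1 hU z hz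
  have hder : ∀ᵐ a ∂μ, ∀ w ∈ Metric.ball z (r / 2),
      HasDerivAt (fun σ => F σ a) (deriv (fun σ => F σ a) w) w := by
    filter_upwards [hd] with a ha w hw
    exact (ha.differentiableAt (hU.mem_nhds (hrU (Metric.ball_subset_ball (by linarith) hw)))).hasDerivAt
  -- Cauchy's estimate on circles of radius r/4 about points of the ball of radius r/2; these
  -- circles stay inside the ball of radius r.
  have hbd : ∀ᵐ a ∂μ, ∀ w ∈ Metric.ball z (r / 2),
      ‖deriv (fun σ => F σ a) w‖ ≤ bound a / (r / 4) := by
    filter_upwards [hd, hb] with a ha hba w hw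
    have hsub : Metric.closedBall w (r / 4) ⊆ U := by
      intro v hv
      apply hrU
      rw [Metric.mem_ball] at hw ⊢
      rw [Metric.mem_closedBall] at hv
      linarith [dist_triangle v w z]
    refine Complex.norm_deriv_le_of_forall_mem_sphere_norm_le (by positivity) ?_ ?_
    · exact (ha.mono hsub).diffContOnCl_ball subset_rfl
    · exact fun v hv => hba v (hsub (Metric.sphere_subset_closedBall hv))
  -- The derivative is a pointwise limit of difference quotients. The increments r/(n + 2) are
  -- nonzero, smaller than r and tend to 0.
  have hmeas : AEStronglyMeasurable (fun a => deriv (fun σ => F σ a) z) μ := by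
    have hzn : ∀ n : ℕ, z + ((r / (n + 2) : ℝ) : ℂ) ∈ U := by
      intro n
      apply hrU
      rw [Metric.mem_ball, dist_eq_norm, add_sub_cancel_left, Complex.norm_real,
        Real.norm_of_nonneg (by positivity), div_lt_iff₀ (by positivity)]
      nlinarith [(Nat.cast_nonneg n : (0 : ℝ) ≤ n)]
    refine aestronglyMeasurable_of_tendsto_ae (u := atTop)
      (f := fun (n : ℕ) a => ((r / (n + 2) : ℝ) : ℂ)⁻¹ • (F (z + ((r / (n + 2) : ℝ) : ℂ)) a - F z a))
      (fun n => ((hm _ (hzn n)).sub (hm z hz)).const_smul ((r / (n + 2) : ℝ) : ℂ)⁻¹) ?_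
    filter_upwards [hder] with a ha
    have h1 := (ha z (Metric.mem_ball_self (by positivity))).tendsto_slope_zero
    refine h1.comp (tendsto_nhdsWithin_iff.2 ⟨?_, Eventually.of_forall fun n => ?_⟩)
    · rw [← Complex.ofReal_zero]
      refine (Complex.continuous_ofReal.tendsto 0).comp ?_
      exact tendsto_const_nhds.div_atTop
        (tendsto_atTop_add_const_right _ _ tendsto_natCast_atTop_atTop)
    · simp only [mem_compl_iff, mem_singleton_iff, Complex.ofReal_eq_zero]
      positivity
  refine (hasDerivAt_integral_of_dominated_loc_of_deriv_le
    (Metric.ball_mem_nhds z (by positivity : 0 < r / 2)) ?_ ?_ hmeas hbd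
    (hi.div_const _) hder).2.differentiableAt.differentiableWithinAt
  · filter_upwards [hU.mem_nhds hz] with w hw using hm w hw
  · refine hi.mono' (hm z hz) ?_
    filter_upwards [hb] with a ha using ha z hz

lemma differentiable_hexpTerm {α : ℝ → ℝ} (hα : Integrable α) (x b : ℝ) (j : ℕ) :
    Differentiable ℂ (hexpTerm x b α j) := by
  intro z
  obtain ⟨K, hK0, hK⟩ := exists_abs_kappa_le x b j
  have h1 : Integrable (fun s : Fin j → ℝ => ∏ i, α (s i)) :=
    Integrable.fintype_prod (f := fun _ => α) fun _ => hα
  have hz : z ∈ Metric.ball (0 : ℂ) (‖z‖ + 1) := by simp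
  refine (differentiableOn_integral_of_norm_le (Metric.isOpen_ball (x := (0 : ℂ)) (ε := ‖z‖ + 1))
    (F := fun σ (s : Fin j → ℝ) =>
      Complex.exp (2 * Complex.I * σ * (kappa x j s : ℂ)) * ((∏ i, α (s i) : ℝ) : ℂ))
    (bound := fun s => Real.exp (2 * (‖z‖ + 1) * K) * ‖∏ i, α (s i)‖)
    (fun σ _ => (integrableOn_simplex_integrand hα x b j σ).aestronglyMeasurable)
    (Eventually.of_forall fun s => ?_) ?_ (h1.norm.const_mul _).integrableOn).differentiableAt
    (Metric.isOpen_ball.mem_nhds hz)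
  · fun_prop
  · filter_upwards [ae_restrict_mem (measurableSet_orderedSimplex x b j)] with s hs σ hσ
    rw [norm_mul, Complex.norm_real]
    gcongr
    refine (norm_exp_two_I_mul_le _ _).trans ?_
    gcongr
    · exact (Complex.abs_im_le_norm σ).trans ((mem_ball_zero_iff.1 hσ).le)
    · exact hK s hs

/-! ### Calculus of absolutely continuous functions. -/

section AbsolutelyContinuous

variable {E F : Type*} [NormedAddCommGroup E] [NormedAddCommGroup F]

open AbsolutelyContinuousOnInterval in
lemma absolutelyContinuousOnInterval_congr {f g : ℝ → E} {a b : ℝ}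
    (hf : AbsolutelyContinuousOnInterval f a b) (h : ∀ x ∈ uIcc a b, g x = f x) :
    AbsolutelyContinuousOnInterval g a b := by
  rw [absolutelyContinuousOnInterval_iff] at hf ⊢
  intro ε hε
  obtain ⟨δ, hδ, H⟩ := hf ε hε
  refine ⟨δ, hδ, fun I hI hs => ?_⟩
  rw [Finset.sum_congr rfl fun i hi => by rw [h _ (hI.1 i hi).1, h _ (hI.1 i hi).2]]
  exact H I hI hs

open AbsolutelyContinuousOnInterval in
lemma absolutelyContinuousOnInterval_lipschitz_comp {f : ℝ → E} {g : E → F} {s : Set E}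
    {K : NNReal} {a b : ℝ} (hg : LipschitzOnWith K g s) (hs : MapsTo f (uIcc a b) s)
    (hf : AbsolutelyContinuousOnInterval f a b) :
    AbsolutelyContinuousOnInterval (fun x => g (f x)) a b := by
  rw [absolutelyContinuousOnInterval_iff] at hf ⊢
  intro ε hε
  -- The denominator K + 1 covers the case K = 0.
  obtain ⟨δ, hδ, H⟩ := hf (ε / (K + 1)) (by positivity)
  refine ⟨δ, hδ, fun I hI hd => ?_⟩
  have h1 : ∑ i ∈ Finset.range I.1, dist (g (f (I.2 i).1)) (g (f (I.2 i).2)) ≤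
      K * ∑ i ∈ Finset.range I.1, dist (f (I.2 i).1) (f (I.2 i).2) := by
    rw [Finset.mul_sum]
    exact Finset.sum_le_sum fun i hi =>
      hg.dist_le_mul _ (hs (hI.1 i hi).1) _ (hs (hI.1 i hi).2)
  have h2 := H I hI hd
  rw [lt_div_iff₀ (by positivity)] at h2
  have h3 : 0 ≤ ∑ i ∈ Finset.range I.1, dist (f (I.2 i).1) (f (I.2 i).2) :=
    Finset.sum_nonneg fun _ _ => dist_nonneg
  nlinarith

lemma absolutelyContinuousOnInterval_norm_sq {f : ℝ → E} {a b : ℝ}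
    (hf : AbsolutelyContinuousOnInterval f a b) :
    AbsolutelyContinuousOnInterval (fun x => ‖f x‖ ^ 2) a b := by
  have h : AbsolutelyContinuousOnInterval (fun x => ‖f x‖) a b :=
    absolutelyContinuousOnInterval_lipschitz_comp
      (lipschitzWith_one_norm.lipschitzOnWith (s := univ)) (mapsTo_univ _ _) hf
  refine absolutelyContinuousOnInterval_congr (h.mul h) fun x _ => ?_
  simp [sq]

end AbsolutelyContinuous

lemma absolutelyContinuousOnInterval_integral {u : ℝ → ℂ} {a b : ℝ}
    (hu : IntervalIntegrable u volume a b) :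
    AbsolutelyContinuousOnInterval (fun x => ∫ t in a..x, u t) a b := by
  have hre : IntervalIntegrable (fun t => (u t).re) volume a b := ⟨hu.1.re, hu.2.re⟩
  have him : IntervalIntegrable (fun t => (u t).im) volume a b := ⟨hu.1.im, hu.2.im⟩
  have h1 := hre.absolutelyContinuousOnInterval_intervalIntegral (left_mem_uIcc (a := a) (b := b))
  have h2 := him.absolutelyContinuousOnInterval_intervalIntegral (left_mem_uIcc (a := a) (b := b))
  have h3 := absolutelyContinuousOnInterval_lipschitz_comp
    (Complex.isometry_ofReal.lipschitz.lipschitzOnWith (s := univ)) (mapsTo_univ _ _) h1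
  have h4 := absolutelyContinuousOnInterval_lipschitz_comp
    (Complex.isometry_ofReal.lipschitz.lipschitzOnWith (s := univ)) (mapsTo_univ _ _) h2
  refine absolutelyContinuousOnInterval_congr (h3.add (h4.const_smul Complex.I)) fun x hx => ?_
  have hux : IntervalIntegrable u volume a x :=
    hu.mono_set (uIcc_subset_uIcc left_mem_uIcc hx)
  simp only [Pi.add_apply, smul_eq_mul]
  rw [← intervalIntegral.integral_ofReal, ← intervalIntegral.integral_ofReal,
    ← intervalIntegral.integral_const_mul, ← intervalIntegral.integral_add]
  · congr 1
    ext t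
    rw [mul_comm]
    exact (Complex.re_add_im _).symm
  · exact ⟨(hux.1.re).ofReal, (hux.2.re).ofReal⟩
  · exact IntervalIntegrable.const_mul ⟨(hux.1.im).ofReal, (hux.2.im).ofReal⟩ _

/-- A function that is the integral of `u` on `[a, b]` is absolutely continuous with derivative `u`
almost everywhere. -/
lemma absolutelyContinuous_of_eq_integral {f u : ℝ → ℂ} {a b : ℝ} (hab : a ≤ b)
    (hu : IntervalIntegrable u volume a b)
    (h : ∀ x ∈ Icc a b, f x = f a + ∫ t in a..x, u t) :
    AbsolutelyContinuousOnInterval f a b ∧ ∀ᵐ x, x ∈ Ioo a b → HasDerivAt f (u x) x := by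
  constructor
  · have hc : AbsolutelyContinuousOnInterval (fun _ : ℝ => f a) a b :=
      (LipschitzWith.const (f a)).lipschitzOnWith.absolutelyContinuousOnInterval
    refine absolutelyContinuousOnInterval_congr
      (hc.add (absolutelyContinuousOnInterval_integral hu)) fun x hx => ?_
    rw [uIcc_of_le hab] at hx
    exact h x hx
  · filter_upwards [hu.ae_hasDerivAt_integral] with x hx hxm
    have hx' := hx (by rw [uIcc_of_le hab]; exact Ioo_subset_Icc_self hxm) a left_mem_uIcc
    refine (hx'.const_add (f a)).congr_of_eventuallyEq ?_
    filter_upwards [Ioo_mem_nhds hxm.1 hxm.2] with y hy using h y (Ioo_subset_Icc_self hy)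

lemma ae_mem_Ioo_of_mem_Icc (a b : ℝ) : ∀ᵐ x : ℝ, x ∈ Icc a b → x ∈ Ioo a b := by
  have h₁ : ∀ᵐ x : ℝ, x ≠ a := by simp [ae_iff, measure_singleton]
  have h₂ : ∀ᵐ x : ℝ, x ≠ b := by simp [ae_iff, measure_singleton]
  filter_upwards [h₁, h₂] with x h1 h2 h
  exact ⟨lt_of_le_of_ne h.1 (Ne.symm h1), lt_of_le_of_ne h.2 h2⟩

lemma eq_left_of_ae_hasDerivAt_zero {E : Type*} [NormedAddCommGroup E] [NormedSpace ℝ E]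
    {f : ℝ → E} {a b : ℝ} (hab : a ≤ b)
    (hf : AbsolutelyContinuousOnInterval f a b)
    (h : ∀ᵐ x, x ∈ Ioo a b → HasDerivAt f 0 x) : ∀ x ∈ Icc a b, f x = f a := by
  have h0 : ∀ᵐ x, x ∈ uIcc a b → HasDerivAt f 0 x := by
    filter_upwards [h, ae_mem_Ioo_of_mem_Icc a b] with x hx hx' hm
    rw [uIcc_of_le hab] at hm
    exact hx (hx' hm)
  obtain ⟨c, hc⟩ := hf.const_of_ae_hasDerivAt_zero h0
  intro x hx
  rw [hc x (by rwa [uIcc_of_le hab]), hc a left_mem_uIcc]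

/-- Integral form of a differential identity for an absolutely continuous real function. -/
lemma integral_eq_sub_of_ae_hasDerivAt {f u : ℝ → ℝ} {a b : ℝ} (hab : a ≤ b)
    (hf : AbsolutelyContinuousOnInterval f a b)
    (h : ∀ᵐ x, x ∈ Ioo a b → HasDerivAt f (u x) x) : ∫ x in a..b, u x = f b - f a := by
  rw [← hf.integral_deriv_eq_sub]
  refine intervalIntegral.integral_congr_ae ?_
  filter_upwards [h, ae_mem_Ioo_of_mem_Icc a b] with x hx hx' hm
  rw [uIoc_of_le hab] at hm
  exact (hx (hx' (Ioc_subset_Icc_self hm))).deriv.symm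

/-- The tail A has derivative -β almost everywhere, so the integrand is, up to the factor -(n + 1),
the derivative of A^(n+1), which vanishes at `b`. Iteration produces the factorials in the bounds
for the simplex integrals. -/
lemma integral_mul_pow_tail {β : ℝ → ℝ} (hβ : Integrable β) (n : ℕ) {x b : ℝ} (hxb : x ≤ b) :
    ∫ t in x..b, β t * (∫ s in t..b, β s) ^ n = (∫ t in x..b, β t) ^ (n + 1) / (n + 1) := by
  have hint : ∀ c d, IntervalIntegrable β volume c d := fun c d => hβ.intervalIntegrable
  set A : ℝ → ℝ := fun t => ∫ s in t..b, β s with hA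
  have hAC : AbsolutelyContinuousOnInterval A x b := by
    refine absolutelyContinuousOnInterval_congr
      ((hint x b).absolutelyContinuousOnInterval_intervalIntegral right_mem_uIcc).neg fun t _ => ?_
    rw [hA, Pi.neg_apply]
    exact intervalIntegral.integral_symm _ _
  have hd : ∀ᵐ t, HasDerivAt A (-β t) t := by
    filter_upwards [_root_.LocallyIntegrable.ae_hasDerivAt_integral hβ.locallyIntegrable] with t ht
    refine (ht b).neg.congr_of_eventuallyEq (Eventually.of_forall fun s => ?_)
    exact intervalIntegral.integral_symm _ _
  have hpow : ∀ m : ℕ, AbsolutelyContinuousOnInterval (fun t => A t ^ (m + 1)) x b := by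
    intro m
    induction m with
    | zero => simpa using hAC
    | succ m ih =>
      refine absolutelyContinuousOnInterval_congr (ih.mul hAC) fun t _ => ?_
      simp [pow_succ]
  have h1 := integral_eq_sub_of_ae_hasDerivAt (u := fun t => (n + 1 : ℝ) * A t ^ n * -β t) hxb
    (hpow n) (by
      filter_upwards [hd] with t ht _
      exact (ht.fun_pow (n + 1)).congr_deriv (by simp))
  have hb : A b = 0 := by simp [hA]
  rw [hb, zero_pow (Nat.succ_ne_zero n), zero_sub] at h1
  have h2 : ∫ t in x..b, (n + 1 : ℝ) * A t ^ n * -β t =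
      -(n + 1 : ℝ) * ∫ t in x..b, β t * A t ^ n := by
    rw [← intervalIntegral.integral_const_mul]
    congr 1
    ext t
    ring
  rw [h2] at h1
  have h3 : (n + 1 : ℝ) ≠ 0 := by positivity
  rw [eq_div_iff h3]
  simp only [hA] at h1 ⊢
  linarith

lemma eq_add_integral_of_ae_hasDerivAt {f u : ℝ → ℂ} {a b : ℝ} (hab : a ≤ b)
    (hf : AbsolutelyContinuousOnInterval f a b) (hu : IntervalIntegrable u volume a b)
    (h : ∀ᵐ x, x ∈ Ioo a b → HasDerivAt f (u x) x) :
    ∀ x ∈ Icc a b, f x = f a + ∫ t in a..x, u t := by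
  have hp := absolutelyContinuous_of_eq_integral (f := fun x => ∫ t in a..x, u t) hab hu
    (by simp)
  intro x hx
  have h0 := eq_left_of_ae_hasDerivAt_zero hab (hf.sub hp.1) (by
    filter_upwards [h, hp.2] with y h1 h2 hy
    simpa using (h1 hy).sub (h2 hy)) x hx
  simp only [Pi.sub_apply, intervalIntegral.integral_same, sub_zero] at h0
  rw [← h0]
  ring

lemma intervalIntegrable_mul_continuousOn {α : ℝ → ℝ} (hα : Integrable α) {a b : ℝ} (hab : a ≤ b)
    {f : ℝ → ℂ} (hf : ContinuousOn f (Icc a b)) :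
    IntervalIntegrable (fun t => (α t : ℂ) * f t) volume a b := by
  rw [intervalIntegrable_iff_integrableOn_Icc_of_le hab]
  exact hα.ofReal.integrableOn.mul_continuousOn hf isCompact_Icc

/-- Separating x from t turns the recursion into a smooth factor in x times a primitive whose
integrand no longer depends on x. -/
lemma exp_gap (σ : ℂ) (p t x : ℝ) : Complex.exp (2 * Complex.I * σ * (p * (t - x) : ℝ)) =
    Complex.exp (-(2 * Complex.I * σ * p * x)) * Complex.exp (2 * Complex.I * σ * p * t) := by
  rw [← Complex.exp_add]
  congr 1
  push_cast
  ring

/-! ### The even and odd parts as functions of the left endpoint. -/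

section Tail

variable {α : ℝ → ℝ} (hα : Integrable α) {a b : ℝ} (σ : ℂ)

include hα in
lemma hexpTerm_succ_eq_intervalIntegral {x : ℝ} (hx : x ≤ b) (j : ℕ) :
    hexpTerm x b α (j + 1) σ = ∫ t in x..b, α t *
      (Complex.exp (2 * Complex.I * σ * (gapWeight j * (t - x) : ℝ)) * hexpTerm t b α j σ) := by
  rw [hexpTerm_succ hα, intervalIntegral.integral_of_le hx, integral_Ioc_eq_integral_Ioo]
  simp only [mul_assoc]

include hα in
lemma continuousOn_hexpTerm (hab : a ≤ b) (j : ℕ) :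
    ContinuousOn (fun x => hexpTerm x b α j σ) (Icc a b) := by
  induction j with
  | zero =>
    simp only [hexpTerm_zero]
    exact continuousOn_const
  | succ j ih =>
    have h1 : ContinuousOn (fun t : ℝ => Complex.exp (2 * Complex.I * σ * gapWeight j * t) *
        hexpTerm t b α j σ) (Icc a b) := ContinuousOn.mul (by fun_prop) ih
    have h2 := intervalIntegrable_mul_continuousOn hα hab h1
    have h3 : ContinuousOn (fun x : ℝ => Complex.exp (-(2 * Complex.I * σ * gapWeight j * x)) *
        ∫ t in x..b, α t * (Complex.exp (2 * Complex.I * σ * gapWeight j * t) *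
        hexpTerm t b α j σ)) (Icc a b) := by
      refine ContinuousOn.mul (by fun_prop) ?_
      have := intervalIntegral.continuousOn_primitive_interval_left (a := a) (b := b)
        (by rw [uIcc_of_le hab]
            exact (intervalIntegrable_iff_integrableOn_Icc_of_le hab).1 h2)
      rwa [uIcc_of_le hab] at this
    refine h3.congr fun x hx => ?_
    simp only
    rw [hexpTerm_succ_eq_intervalIntegral hα σ hx.2, ← intervalIntegral.integral_const_mul]
    congr 1
    ext t
    rw [exp_gap]
    ring

lemma abs_gapWeight_le (j : ℕ) : |gapWeight j| ≤ 1 := by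
  unfold gapWeight
  split_ifs <;> simp

lemma norm_exp_gap_le (j : ℕ) {x t : ℝ} (h : x ≤ t) :
    ‖Complex.exp (2 * Complex.I * σ * (gapWeight j * (t - x) : ℝ))‖ ≤
      Real.exp (2 * |σ.im| * (t - x)) := by
  refine (norm_exp_two_I_mul_le σ _).trans ?_
  rw [abs_mul, abs_of_nonneg (sub_nonneg.2 h)]
  gcongr
  exact mul_le_of_le_one_left (sub_nonneg.2 h) (abs_gapWeight_le j)

-- The exponential bounds for successive gaps multiply to a single factor e^{2|Im σ|(b-x)}, so no
-- powers of it accumulate; the iterated integrals of |α| give the factor 1/j!.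
include hα in
lemma norm_hexpTerm_le_tail (j : ℕ) {x : ℝ} (hx : x ≤ b) :
    ‖hexpTerm x b α j σ‖ ≤
      Real.exp (2 * |σ.im| * (b - x)) * ((∫ t in x..b, |α t|) ^ j / j.factorial) := by
  induction j generalizing x with
  | zero =>
    simp only [hexpTerm_zero, norm_one, pow_zero, Nat.factorial_zero, Nat.cast_one, div_one, mul_one]
    exact Real.one_le_exp (mul_nonneg (by positivity) (sub_nonneg.2 hx))
  | succ j ih =>
    have hAc : ContinuousOn (fun t => (∫ s in t..b, |α s|) ^ j) (Icc x b) := by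
      have := (intervalIntegral.continuousOn_primitive_interval_left (a := x) (b := b)
        (hα.abs.integrableOn (μ := volume) (s := uIcc x b))).pow j
      rwa [uIcc_of_le hx] at this
    have hint : IntervalIntegrable (fun t => |α t| * (∫ s in t..b, |α s|) ^ j) volume x b := by
      rw [intervalIntegrable_iff_integrableOn_Icc_of_le hx]
      exact hα.abs.integrableOn.mul_continuousOn hAc isCompact_Icc
    rw [hexpTerm_succ_eq_intervalIntegral hα σ hx]
    refine (intervalIntegral.norm_integral_le_of_norm_le
      (g := fun t => (Real.exp (2 * |σ.im| * (b - x)) / j.factorial) *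
        (|α t| * (∫ s in t..b, |α s|) ^ j)) hx (Eventually.of_forall fun t ht => ?_)
        (hint.const_mul _)).trans (le_of_eq ?_)
    · rw [norm_mul, norm_mul, Complex.norm_real, Real.norm_eq_abs]
      calc |α t| * (‖Complex.exp (2 * Complex.I * σ * (gapWeight j * (t - x) : ℝ))‖ *
            ‖hexpTerm t b α j σ‖) ≤ |α t| * (Real.exp (2 * |σ.im| * (t - x)) *
            (Real.exp (2 * |σ.im| * (b - t)) * ((∫ s in t..b, |α s|) ^ j / j.factorial))) := by
            gcongr
            · exact norm_exp_gap_le σ j ht.1.le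
            · exact ih ht.2
        _ = _ := by
            rw [show 2 * |σ.im| * (b - x) = 2 * |σ.im| * (t - x) + 2 * |σ.im| * (b - t) by ring,
              Real.exp_add]
            ring
    · rw [intervalIntegral.integral_const_mul, integral_mul_pow_tail hα.abs j hx,
        Nat.factorial_succ]
      push_cast
      field_simp

-- A bound uniform in x, as needed for normal convergence and for exchanging sum and integral.
include hα in
lemma norm_hexpTerm_le (j : ℕ) {x : ℝ} (hx : x ∈ Icc a b) :
    ‖hexpTerm x b α j σ‖ ≤
      Real.exp (2 * |σ.im| * (b - a)) * ((∫ t, |α t|) ^ j / j.factorial) := by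
  refine (norm_hexpTerm_le_tail hα σ j hx.2).trans ?_
  have h0 : 0 ≤ ∫ t in x..b, |α t| :=
    intervalIntegral.integral_nonneg hx.2 fun _ _ => abs_nonneg _
  gcongr
  · exact hx.1
  · rw [intervalIntegral.integral_of_le hx.2]
    exact setIntegral_le_integral hα.abs (Eventually.of_forall fun _ => abs_nonneg _)

lemma summable_bound (E S : ℝ) : Summable fun j : ℕ => E * (S ^ j / j.factorial) :=
  (Real.summable_pow_div_factorial S).mul_left E

lemma injective_two_mul : Function.Injective fun k : ℕ => 2 * k := fun _ _ h => by simpa using h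

lemma injective_two_mul_add_one : Function.Injective fun k : ℕ => 2 * k + 1 :=
  fun _ _ h => by simpa using h

/-- The even part of the harmonic exponential of `(x, b)`. -/
def evenPart (b : ℝ) (α : ℝ → ℝ) (σ : ℂ) (x : ℝ) : ℂ := ∑' k : ℕ, hexpTerm x b α (2 * k) σ

/-- The odd part of the harmonic exponential of `(x, b)`. -/
def oddPart (b : ℝ) (α : ℝ → ℝ) (σ : ℂ) (x : ℝ) : ℂ := ∑' k : ℕ, hexpTerm x b α (2 * k + 1) σ

include hα in
lemma summable_hexpTerm {x : ℝ} (hx : x ≤ b) : Summable fun j => hexpTerm x b α j σ :=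
  (summable_bound _ _).of_norm_bounded fun j => norm_hexpTerm_le hα σ j (left_mem_Icc.2 hx)

include hα in
lemma hexp_eq {x : ℝ} (hx : x ≤ b) :
    hexp x b α σ = evenPart b α σ x + oddPart b α σ x := by
  have h := summable_hexpTerm hα σ hx
  have h1 : ∑' j, hexpTerm x b α j σ = hexpTerm x b α 0 σ + ∑' j, hexpTerm x b α (j + 1) σ :=
    h.tsum_eq_zero_add
  have he : Summable fun k => hexpTerm x b α (2 * k) σ := h.comp_injective injective_two_mul
  have ho : Summable fun k => hexpTerm x b α (2 * k + 1) σ :=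
    h.comp_injective injective_two_mul_add_one
  have h2 := tsum_even_add_odd (f := fun j => hexpTerm x b α j σ) he ho
  rw [hexpTerm_zero] at h1
  rw [hexp, evenPart, oddPart, ← h1, ← h2]

-- Replacing α by -α changes the sign of the odd terms only.
include hα in
lemma Cosh_eq_evenPart {x : ℝ} (hx : x ≤ b) : Cosh x b α σ = evenPart b α σ x := by
  have hn : Integrable (-α) := hα.neg
  have h1 : evenPart b (-α) σ x = evenPart b α σ x := by
    simp [evenPart, hexpTerm_neg, pow_mul]
  have h2 : oddPart b (-α) σ x = -oddPart b α σ x := by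
    simp [oddPart, hexpTerm_neg, pow_mul, pow_succ, tsum_neg]
  rw [Cosh, hexp_eq hα σ hx, hexp_eq hn σ hx, h1, h2]
  ring

include hα in
lemma continuousOn_evenPart (hab : a ≤ b) : ContinuousOn (evenPart b α σ) (Icc a b) :=
  continuousOn_tsum (fun k => continuousOn_hexpTerm hα σ hab (2 * k))
    ((summable_bound (Real.exp (2 * |σ.im| * (b - a))) (∫ t, |α t|)).comp_injective
      injective_two_mul) fun k _ hx => norm_hexpTerm_le hα σ (2 * k) hx

include hα in
lemma continuousOn_oddPart (hab : a ≤ b) : ContinuousOn (oddPart b α σ) (Icc a b) :=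
  continuousOn_tsum (fun k => continuousOn_hexpTerm hα σ hab (2 * k + 1))
    ((summable_bound (Real.exp (2 * |σ.im| * (b - a))) (∫ t, |α t|)).comp_injective
      injective_two_mul_add_one) fun k _ hx => norm_hexpTerm_le hα σ (2 * k + 1) hx

include hα in
lemma differentiable_tsum_hexpTerm {φ : ℕ → ℕ} (hφ : Function.Injective φ) {x : ℝ} (hx : x ≤ b) :
    Differentiable ℂ fun σ => ∑' k, hexpTerm x b α (φ k) σ := by
  intro z
  refine (Complex.differentiableOn_tsum_of_summable_norm (U := Metric.ball (0 : ℂ) (‖z‖ + 1))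
    ((summable_bound (Real.exp (2 * (‖z‖ + 1) * (b - x))) (∫ t, |α t|)).comp_injective hφ)
    (fun k => (differentiable_hexpTerm hα x b (φ k)).differentiableOn) Metric.isOpen_ball
    fun k σ hσ => ?_).differentiableAt (Metric.isOpen_ball.mem_nhds (by simp))
  refine (norm_hexpTerm_le hα σ (φ k) (left_mem_Icc.2 hx)).trans ?_
  have h0 : 0 ≤ ∫ t, |α t| := integral_nonneg fun _ => abs_nonneg _
  have h1 : |σ.im| ≤ ‖z‖ + 1 := (Complex.abs_im_le_norm σ).trans (mem_ball_zero_iff.1 hσ).le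
  have h2 : 0 ≤ b - x := sub_nonneg.2 hx
  simp only [Function.comp]
  gcongr

-- The gap weight is constant along the even and along the odd indices, so the recursion can be
-- summed over either class. Weight 0 leads from the odd to the even part without an exponential;
-- weight 1 leads from the even to the odd part.
include hα in
lemma hasSum_hexpTerm_succ {x : ℝ} (hx : x ≤ b) {φ : ℕ → ℕ} (hφ : Function.Injective φ) {p : ℝ}
    (hp : ∀ k, gapWeight (φ k) = p) :
    HasSum (fun k => hexpTerm x b α (φ k + 1) σ) (∫ t in x..b, α t *
      (Complex.exp (2 * Complex.I * σ * (p * (t - x) : ℝ)) * ∑' k, hexpTerm t b α (φ k) σ)) := by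
  have hs : ∀ {t : ℝ}, t ≤ b → Summable fun j => hexpTerm t b α j σ := summable_hexpTerm hα σ
  simp_rw [fun k => hexpTerm_succ_eq_intervalIntegral hα σ hx (φ k), hp]
  have hsb := (summable_bound (Real.exp (2 * |σ.im| * (b - x))) (∫ t, |α t|)).comp_injective hφ
  refine intervalIntegral.hasSum_integral_of_dominated_convergence
    (fun k t => (|α t| * Real.exp (2 * |σ.im| * (b - x))) *
      (Real.exp (2 * |σ.im| * (b - x)) * ((∫ t, |α t|) ^ (φ k) / (φ k).factorial)))
    (fun k => ?_) (fun k => Eventually.of_forall fun t ht => ?_)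
    (Eventually.of_forall fun t _ => hsb.mul_left _) ?_ (Eventually.of_forall fun t ht => ?_)
  · have := intervalIntegrable_mul_continuousOn hα hx (f := fun t =>
      Complex.exp (2 * Complex.I * σ * (p * (t - x) : ℝ)) * hexpTerm t b α (φ k) σ)
      (ContinuousOn.mul (by fun_prop) (continuousOn_hexpTerm hα σ hx (φ k)))
    exact (intervalIntegrable_iff.1 this).aestronglyMeasurable
  · rw [uIoc_of_le hx] at ht
    rw [norm_mul, norm_mul, Complex.norm_real, Real.norm_eq_abs, ← mul_assoc]
    gcongr
    · rw [← hp k]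
      refine (norm_exp_gap_le σ (φ k) ht.1.le).trans ?_
      gcongr
      exact ht.2
    · exact norm_hexpTerm_le hα σ (φ k) (Ioc_subset_Icc_self ht)
  · simp_rw [tsum_mul_left]
    exact ((hα.abs.mul_const _).mul_const _).intervalIntegrable
  · rw [uIoc_of_le hx] at ht
    exact (((hs ht.2).comp_injective hφ).hasSum.mul_left _).mul_left _

include hα in
lemma evenPart_eq {x : ℝ} (hx : x ≤ b) :
    evenPart b α σ x = 1 + ∫ t in x..b, α t * oddPart b α σ t := by
  have h := hasSum_hexpTerm_succ hα σ hx injective_two_mul_add_one (p := 0)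
    (fun k => by simp [gapWeight])
  have h1 := ((summable_hexpTerm hα σ hx).comp_injective injective_two_mul).tsum_eq_zero_add
  simp only [Function.comp, mul_zero, hexpTerm_zero] at h1
  have h2 : ∀ k, 2 * (k + 1) = 2 * k + 1 + 1 := fun k => by ring
  simp only [h2, h.tsum_eq] at h1
  rw [evenPart, h1]
  simp [oddPart]

include hα in
lemma oddPart_eq {x : ℝ} (hx : x ≤ b) :
    oddPart b α σ x = Complex.exp (-(2 * Complex.I * σ * x)) *
      ∫ t in x..b, α t * (Complex.exp (2 * Complex.I * σ * t) * evenPart b α σ t) := by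
  have h := hasSum_hexpTerm_succ hα σ hx injective_two_mul (p := 1)
    (fun k => by simp [gapWeight])
  rw [oddPart, h.tsum_eq, ← intervalIntegral.integral_const_mul]
  congr 1
  ext t
  rw [exp_gap]
  simp only [evenPart, Complex.ofReal_one, mul_one]
  ring

include hα in
lemma evenPart_ac (hab : a ≤ b) : AbsolutelyContinuousOnInterval (evenPart b α σ) a b ∧
    ∀ᵐ x, x ∈ Ioo a b → HasDerivAt (evenPart b α σ) (-(α x * oddPart b α σ x)) x := by
  have hi := intervalIntegrable_mul_continuousOn hα hab (continuousOn_oddPart hα σ hab)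
  refine absolutelyContinuous_of_eq_integral hab hi.neg fun x hx => ?_
  rw [evenPart_eq hα σ hx.2, evenPart_eq hα σ hab, intervalIntegral.integral_neg,
    ← intervalIntegral.integral_add_adjacent_intervals (b := x)
      (hi.mono_set (uIcc_subset_uIcc left_mem_uIcc (by rwa [uIcc_of_le hab])))
      (hi.mono_set (uIcc_subset_uIcc (by rwa [uIcc_of_le hab]) right_mem_uIcc))]
  ring

include hα in
lemma oddPart_ac (hab : a ≤ b) : AbsolutelyContinuousOnInterval (oddPart b α σ) a b ∧
    ∀ᵐ x, x ∈ Ioo a b → HasDerivAt (oddPart b α σ)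
      (-(α x * evenPart b α σ x) - 2 * Complex.I * σ * oddPart b α σ x) x := by
  have hi := intervalIntegrable_mul_continuousOn hα hab (f := fun t =>
    Complex.exp (2 * Complex.I * σ * t) * evenPart b α σ t)
    (ContinuousOn.mul (by fun_prop) (continuousOn_evenPart hα σ hab))
  set H : ℝ → ℂ := fun x =>
    ∫ t in x..b, α t * (Complex.exp (2 * Complex.I * σ * t) * evenPart b α σ t) with hH
  obtain ⟨h1, h2⟩ := absolutelyContinuous_of_eq_integral (f := H) hab hi.neg fun x hx => by
    rw [hH]
    simp only [Pi.neg_apply]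
    rw [intervalIntegral.integral_neg,
      ← intervalIntegral.integral_add_adjacent_intervals (b := x)
      (hi.mono_set (uIcc_subset_uIcc left_mem_uIcc (by rwa [uIcc_of_le hab])))
      (hi.mono_set (uIcc_subset_uIcc (by rwa [uIcc_of_le hab]) right_mem_uIcc))]
    ring
  have hE : AbsolutelyContinuousOnInterval
      (fun x : ℝ => Complex.exp (-(2 * Complex.I * σ * x))) a b := by
    refine ContDiffOn.absolutelyContinuousOnInterval (ContDiff.contDiffOn ?_)
    exact (contDiff_const.mul Complex.ofRealCLM.contDiff).neg.cexp
  have heq : ∀ x ≤ b, oddPart b α σ x = Complex.exp (-(2 * Complex.I * σ * x)) * H x :=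
    fun x hx => oddPart_eq hα σ hx
  refine ⟨absolutelyContinuousOnInterval_congr (hE.smul h1) fun x hx => ?_, ?_⟩
  · rw [uIcc_of_le hab] at hx
    simpa using heq x hx.2
  · filter_upwards [h2] with x hx hm
    have d1 : HasDerivAt (fun y : ℝ => Complex.exp (-(2 * Complex.I * σ * y)))
        (Complex.exp (-(2 * Complex.I * σ * x)) * (-(2 * Complex.I * σ))) x := by
      have := ((Complex.ofRealCLM.hasDerivAt (x := x)).const_mul (2 * Complex.I * σ)).neg.cexp
      simpa using this
    have d2 := (d1.mul (hx hm)).congr_of_eventuallyEq (f₁ := oddPart b α σ) (by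
      filter_upwards [Iio_mem_nhds hm.2] with y hy using heq y (le_of_lt hy))
    refine d2.congr_deriv ?_
    rw [heq x hm.2.le]
    have e : Complex.exp (-(2 * Complex.I * σ * x)) * Complex.exp (2 * Complex.I * σ * x) = 1 := by
      rw [← Complex.exp_add]
      simp
    simp only [Pi.neg_apply]
    linear_combination (-(α x * evenPart b α σ x)) * e

end Tail

/-! ### Energy estimate and the bounded logarithm of `Sech`. -/

section Energy

variable {α : ℝ → ℝ} (hα : Integrable α) {a b : ℝ} {σ : ℂ}

include hα in
lemma evenPart_right : evenPart b α σ b = 1 := by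
  rw [evenPart_eq hα σ le_rfl]
  simp

include hα in
lemma oddPart_right : oddPart b α σ b = 0 := by
  rw [oddPart_eq hα σ le_rfl]
  simp

-- The derivative of |c|² - |g|² is -4 Im σ |g|² ≤ 0: the terms with α cancel because α is real. At
-- the right endpoint the difference equals 1.
include hα in
lemma one_add_norm_oddPart_sq_le (hσ : 0 ≤ σ.im) {x : ℝ} (hx : x ≤ b) :
    1 + ‖oddPart b α σ x‖ ^ 2 ≤ ‖evenPart b α σ x‖ ^ 2 := by
  obtain ⟨c1, c2⟩ := evenPart_ac hα σ hx
  obtain ⟨g1, g2⟩ := oddPart_ac hα σ hx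
  have h := integral_eq_sub_of_ae_hasDerivAt (u := fun t => -(4 * σ.im * ‖oddPart b α σ t‖ ^ 2)) hx
    ((absolutelyContinuousOnInterval_norm_sq c1).sub (absolutelyContinuousOnInterval_norm_sq g1)) (by
      filter_upwards [c2, g2] with t hc hg ht
      refine ((hc ht).norm_sq.sub (hg ht).norm_sq).congr_deriv ?_
      rw [Complex.inner, Complex.inner, ← Complex.normSq_eq_norm_sq, Complex.normSq_apply]
      simp
      ring)
  have h2 : ∫ t in x..b, -(4 * σ.im * ‖oddPart b α σ t‖ ^ 2) ≤ 0 := by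
    rw [intervalIntegral.integral_neg, neg_nonpos]
    exact intervalIntegral.integral_nonneg hx fun t _ => by positivity
  rw [h] at h2
  simp only [Pi.sub_apply, evenPart_right hα, oddPart_right hα] at h2
  norm_num at h2
  linarith

include hα in
lemma one_le_norm_evenPart (hσ : 0 ≤ σ.im) {x : ℝ} (hx : x ≤ b) : 1 ≤ ‖evenPart b α σ x‖ := by
  have h := one_add_norm_oddPart_sq_le hα hσ hx
  nlinarith [norm_nonneg (evenPart b α σ x), sq_nonneg ‖oddPart b α σ x‖]

include hα in
lemma evenPart_ne_zero (hσ : 0 ≤ σ.im) {x : ℝ} (hx : x ≤ b) : evenPart b α σ x ≠ 0 :=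
  norm_pos_iff.1 (lt_of_lt_of_le one_pos (one_le_norm_evenPart hα hσ hx))

include hα in
lemma norm_oddPart_div_evenPart_le (hσ : 0 ≤ σ.im) {x : ℝ} (hx : x ≤ b) :
    ‖oddPart b α σ x / evenPart b α σ x‖ ≤ 1 := by
  rw [norm_div, div_le_one (norm_pos_iff.2 (evenPart_ne_zero hα hσ hx))]
  have h := one_add_norm_oddPart_sq_le hα hσ hx
  exact le_of_sq_le_sq (by linarith) (norm_nonneg _)

lemma absolutelyContinuousOnInterval_cexp {f : ℝ → ℂ} (hf : AbsolutelyContinuousOnInterval f a b) :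
    AbsolutelyContinuousOnInterval (fun x => Complex.exp (f x)) a b := by
  obtain ⟨R, hR⟩ := hf.exists_bound
  obtain ⟨K, hK⟩ := (Complex.contDiff_exp (𝕜 := ℝ) (n := 1)).contDiffOn.exists_lipschitzOnWith
    (s := Metric.closedBall 0 R) (by decide) (convex_closedBall _ _) (isCompact_closedBall _ _)
  exact absolutelyContinuousOnInterval_lipschitz_comp hK
    (fun x hx => mem_closedBall_zero_iff.2 (hR x hx)) hf

/-- The logarithm of the hyperbolic secant that is continuous on the closed upper half plane. -/
def logSech (a b : ℝ) (α : ℝ → ℝ) (σ : ℂ) : ℂ :=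
  -∫ x in Ioc a b, α x * (oddPart b α σ x / evenPart b α σ x)

include hα in
lemma continuousOn_oddPart_div_evenPart (hab : a ≤ b) (hσ : 0 ≤ σ.im) :
    ContinuousOn (fun x => oddPart b α σ x / evenPart b α σ x) (Icc a b) :=
  (continuousOn_oddPart hα σ hab).div (continuousOn_evenPart hα σ hab)
    fun _ hx => evenPart_ne_zero hα hσ hx.2

include hα in
lemma exp_logSech (hab : a ≤ b) (hσ : 0 ≤ σ.im) :
    Complex.exp (logSech a b α σ) = Sech a b α σ := by
  have hi := intervalIntegrable_mul_continuousOn hα hab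
    (continuousOn_oddPart_div_evenPart hα hab hσ)
  obtain ⟨u1, u2⟩ := absolutelyContinuous_of_eq_integral
    (f := fun x => ∫ t in a..x, α t * (oddPart b α σ t / evenPart b α σ t)) hab hi (by simp)
  obtain ⟨c1, c2⟩ := evenPart_ac hα σ hab
  -- The product of c and exp(∫_a^x αg/c) has derivative zero almost everywhere; comparing its
  -- values at the two endpoints gives c(a).
  have h := eq_left_of_ae_hasDerivAt_zero hab (c1.smul (absolutelyContinuousOnInterval_cexp u1)) (by
    filter_upwards [c2, u2] with x hc hu hx
    refine ((hc hx).mul (hu hx).cexp).congr_deriv ?_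
    have := evenPart_ne_zero hα hσ hx.2.le
    field_simp
    ring) b (right_mem_Icc.2 hab)
  simp only [Pi.smul_apply', evenPart_right hα, intervalIntegral.integral_same, Complex.exp_zero,
    smul_eq_mul, mul_one, one_mul] at h
  rw [logSech, ← intervalIntegral.integral_of_le hab, Complex.exp_neg, h, Sech,
    Cosh_eq_evenPart hα σ hab, one_div]

include hα in
lemma norm_logSech_integrand_le (hσ : 0 ≤ σ.im) {x : ℝ} (hx : x ≤ b) :
    ‖(α x : ℂ) * (oddPart b α σ x / evenPart b α σ x)‖ ≤ |α x| := by
  rw [norm_mul, Complex.norm_real, Real.norm_eq_abs]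
  exact mul_le_of_le_one_right (abs_nonneg _) (norm_oddPart_div_evenPart_le hα hσ hx)

include hα in
lemma norm_logSech_le (hσ : 0 ≤ σ.im) : ‖logSech a b α σ‖ ≤ ∫ x, |α x| := by
  rw [logSech, norm_neg]
  refine (norm_integral_le_of_norm_le hα.abs.integrableOn ?_).trans
    (setIntegral_le_integral (s := Ioc a b) hα.abs (Eventually.of_forall fun _ => abs_nonneg _))
  filter_upwards [ae_restrict_mem measurableSet_Ioc] with x hx using
    norm_logSech_integrand_le hα hσ hx.2

include hα in
lemma aestronglyMeasurable_logSech_integrand (hab : a ≤ b) (hσ : 0 ≤ σ.im) :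
    AEStronglyMeasurable (fun x => (α x : ℂ) * (oddPart b α σ x / evenPart b α σ x))
      (volume.restrict (Ioc a b)) :=
  (intervalIntegrable_mul_continuousOn hα hab
    (continuousOn_oddPart_div_evenPart hα hab hσ)).1.aestronglyMeasurable

include hα in
lemma differentiable_evenPart {x : ℝ} (hx : x ≤ b) :
    Differentiable ℂ fun σ => evenPart b α σ x :=
  differentiable_tsum_hexpTerm hα injective_two_mul hx

include hα in
lemma differentiable_oddPart {x : ℝ} (hx : x ≤ b) :
    Differentiable ℂ fun σ => oddPart b α σ x :=
  differentiable_tsum_hexpTerm hα injective_two_mul_add_one hx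

-- Dominated convergence with the majorant |α|, independent of σ. It reaches the real line because c
-- has no zeros there and |g/c| ≤ 1 still holds.
include hα in
lemma continuousOn_logSech (hab : a ≤ b) :
    ContinuousOn (logSech a b α) {σ | 0 ≤ σ.im} := by
  refine ContinuousOn.neg (continuousOn_of_dominated (bound := fun x => |α x|)
    (fun σ hσ => aestronglyMeasurable_logSech_integrand hα hab hσ) (fun σ hσ => ?_)
    hα.abs.integrableOn ?_)
  · filter_upwards [ae_restrict_mem measurableSet_Ioc] with x hx using
      norm_logSech_integrand_le hα hσ hx.2
  · filter_upwards [ae_restrict_mem measurableSet_Ioc] with x hx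
    exact continuousOn_const.mul (((differentiable_oddPart hα hx.2).continuous.continuousOn).div
      (differentiable_evenPart hα hx.2).continuous.continuousOn
      fun σ hσ => evenPart_ne_zero hα hσ hx.2)

include hα in
lemma differentiableOn_logSech (hab : a ≤ b) :
    DifferentiableOn ℂ (logSech a b α) {σ | 0 < σ.im} := by
  refine DifferentiableOn.neg (differentiableOn_integral_of_norm_le (bound := fun x => |α x|)
    (isOpen_lt continuous_const Complex.continuous_im)
    (fun σ hσ => aestronglyMeasurable_logSech_integrand hα hab (le_of_lt hσ)) ?_ ?_
    hα.abs.integrableOn)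
  · filter_upwards [ae_restrict_mem measurableSet_Ioc] with x hx
    exact (differentiableOn_const _).mul ((differentiable_oddPart hα hx.2).differentiableOn.div
      (differentiable_evenPart hα hx.2).differentiableOn
      fun σ hσ => evenPart_ne_zero hα (le_of_lt hσ) hx.2)
  · filter_upwards [ae_restrict_mem measurableSet_Ioc] with x hx σ hσ using
      norm_logSech_integrand_le hα (le_of_lt hσ) hx.2

lemma conj_tsum_hexpTerm_I (φ : ℕ → ℕ) (x : ℝ) :
    starRingEnd ℂ (∑' k, hexpTerm x b α (φ k) Complex.I) =
      ∑' k, hexpTerm x b α (φ k) Complex.I := by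
  rw [Complex.conj_tsum]
  exact tsum_congr fun k => Complex.conj_eq_iff_im.2 (hexpTerm_I_im _ _ _ _)

lemma logSech_I_im : (logSech a b α Complex.I).im = 0 := by
  rw [← Complex.conj_eq_iff_im, logSech, map_neg, ← integral_conj]
  congr 2
  ext x
  rw [map_mul, map_div₀, Complex.conj_ofReal, oddPart, evenPart, conj_tsum_hexpTerm_I,
    conj_tsum_hexpTerm_I fun k => 2 * k]

end Energy

/-! ### The boundary value problem for waves of real frequency. -/

section Wave

variable {α : ℝ → ℝ} {x₀ x₁ : ℝ} {σ : ℝ}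

lemma isWaveSolution_congr {β : ℝ → ℝ} (h : EqOn α β (Ioo x₀ x₁)) {a b : ℝ → ℂ}
    (hs : IsWaveSolution x₀ x₁ α σ a b) : IsWaveSolution x₀ x₁ β σ a b := by
  refine ⟨hs.1, hs.2.1, fun x hx => ?_⟩
  have key : ∀ F : ℝ → ℝ → ℂ, ∫ y in x₀..x, F (α y) y = ∫ y in x₀..x, F (β y) y := by
    intro F
    rw [intervalIntegral.integral_of_le hx.1, intervalIntegral.integral_of_le hx.1,
      integral_Ioc_eq_integral_Ioo, integral_Ioc_eq_integral_Ioo]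
    refine setIntegral_congr_fun measurableSet_Ioo fun y hy => ?_
    simp only [h ⟨hy.1, hy.2.trans_le hx.2⟩]
  rw [← key fun α y => Complex.I * σ * a y + α * b y, ← key fun α y => α * a y - Complex.I * σ * b y]
  exact hs.2.2 x hx

variable (hα : Integrable α) (hx : x₀ ≤ x₁)
include hα hx

lemma IsWaveSolution.intervalIntegrable {a b : ℝ → ℂ} (ha : ContinuousOn a (Icc x₀ x₁))
    (hb : ContinuousOn b (Icc x₀ x₁)) (c : ℂ) :
    IntervalIntegrable (fun y => c * a y + α y * b y) volume x₀ x₁ := by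
  refine IntervalIntegrable.add ?_ (intervalIntegrable_mul_continuousOn hα hx hb)
  exact (continuousOn_const.mul (by rwa [uIcc_of_le hx])).intervalIntegrable

lemma IsWaveSolution.intervalIntegrable' {a b : ℝ → ℂ} (ha : ContinuousOn a (Icc x₀ x₁))
    (hb : ContinuousOn b (Icc x₀ x₁)) (c : ℂ) :
    IntervalIntegrable (fun y => α y * a y - c * b y) volume x₀ x₁ := by
  refine IntervalIntegrable.sub (intervalIntegrable_mul_continuousOn hα hx ha) ?_
  exact (continuousOn_const.mul (by rwa [uIcc_of_le hx])).intervalIntegrable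

lemma IsWaveSolution.sub {a b a' b' : ℝ → ℂ} (h : IsWaveSolution x₀ x₁ α σ a b)
    (h' : IsWaveSolution x₀ x₁ α σ a' b') :
    IsWaveSolution x₀ x₁ α σ (a - a') (b - b') := by
  refine ⟨h.1.sub h'.1, h.2.1.sub h'.2.1, fun x hxm => ?_⟩
  have hsub : uIcc x₀ x ⊆ uIcc x₀ x₁ :=
    uIcc_subset_uIcc left_mem_uIcc (by rwa [uIcc_of_le hx])
  have i1 := (intervalIntegrable hα hx h.1 h.2.1 (Complex.I * σ)).mono_set hsub
  have i1' := (intervalIntegrable hα hx h'.1 h'.2.1 (Complex.I * σ)).mono_set hsub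
  have i2 := (intervalIntegrable' hα hx h.1 h.2.1 (Complex.I * σ)).mono_set hsub
  have i2' := (intervalIntegrable' hα hx h'.1 h'.2.1 (Complex.I * σ)).mono_set hsub
  have e1 := intervalIntegral.integral_sub i1 i1'
  have e2 := intervalIntegral.integral_sub i2 i2'
  have f1 : (fun y => Complex.I * σ * (a - a') y + α y * (b - b') y) = fun y =>
      (Complex.I * σ * a y + α y * b y) - (Complex.I * σ * a' y + α y * b' y) := by
    ext y
    simp only [Pi.sub_apply]
    ring
  have f2 : (fun y => α y * (a - a') y - Complex.I * σ * (b - b') y) = fun y =>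
      (α y * a y - Complex.I * σ * b y) - (α y * a' y - Complex.I * σ * b' y) := by
    ext y
    simp only [Pi.sub_apply]
    ring
  rw [f1, f2, e1, e2]
  simp only [Pi.sub_apply]
  rw [(h.2.2 x hxm).1, (h.2.2 x hxm).2, (h'.2.2 x hxm).1, (h'.2.2 x hxm).2]
  constructor <;> ring

/-- The energy flux of a wave of real frequency is constant. -/
lemma IsWaveSolution.energy {a b : ℝ → ℂ} (h : IsWaveSolution x₀ x₁ α σ a b) :
    ‖b x₁‖ ^ 2 - ‖a x₁‖ ^ 2 = ‖b x₀‖ ^ 2 - ‖a x₀‖ ^ 2 := by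
  obtain ⟨a1, a2⟩ := absolutelyContinuous_of_eq_integral hx
    (intervalIntegrable hα hx h.1 h.2.1 (Complex.I * σ)).neg (f := a) fun x hxm => by
      simp only [Pi.neg_apply]
      rw [intervalIntegral.integral_neg, ← sub_eq_add_neg]
      exact (h.2.2 x hxm).1
  obtain ⟨b1, b2⟩ := absolutelyContinuous_of_eq_integral hx
    (intervalIntegrable' hα hx h.1 h.2.1 (Complex.I * σ)).neg (f := b) fun x hxm => by
      simp only [Pi.neg_apply]
      rw [intervalIntegral.integral_neg, ← sub_eq_add_neg]
      exact (h.2.2 x hxm).2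
  refine eq_left_of_ae_hasDerivAt_zero hx ((absolutelyContinuousOnInterval_norm_sq b1).sub
    (absolutelyContinuousOnInterval_norm_sq a1)) ?_ x₁ (right_mem_Icc.2 hx)
  filter_upwards [a2, b2] with t ha hb ht
  refine ((hb ht).norm_sq.sub (ha ht).norm_sq).congr_deriv ?_
  rw [Complex.inner, Complex.inner]
  simp
  ring

/-- The difference of two solutions has b = 0 at the left and a = 0 at the right end, so energy
conservation reads |b(x₁)|² = -|a(x₀)|² and both sides vanish. -/
lemma isTransmittedAmplitude_unique {T T' : ℂ} (h : IsTransmittedAmplitude x₀ x₁ α σ T)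
    (h' : IsTransmittedAmplitude x₀ x₁ α σ T') : T = T' := by
  obtain ⟨a, b, hs, hb, ha, rfl⟩ := h
  obtain ⟨a', b', hs', hb', ha', rfl⟩ := h'
  have he := (hs.sub hα hx hs').energy hα hx
  simp only [Pi.sub_apply, ha, ha', hb, hb', sub_self, norm_zero] at he
  have h0 : ‖b x₁ - b' x₁‖ ^ 2 = 0 := by
    have := sq_nonneg ‖a x₀ - a' x₀‖
    have := sq_nonneg ‖b x₁ - b' x₁‖
    linarith
  rw [sq_eq_zero_iff, norm_eq_zero] at h0
  exact sub_eq_zero.1 h0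

/-- The factor e^{iσx} turns the system for (g, c), with -2iσ acting on g only, into the symmetric
wave system. -/
lemma isTransmittedAmplitude_Sech : IsTransmittedAmplitude x₀ x₁ α σ
    (Complex.exp (Complex.I * (x₁ - x₀) * σ) * Sech x₀ x₁ α (σ : ℂ)) := by
  obtain ⟨c1, c2⟩ := evenPart_ac hα σ hx
  obtain ⟨g1, g2⟩ := oddPart_ac hα σ hx
  have hne : evenPart x₁ α σ x₀ ≠ 0 := evenPart_ne_zero hα (by simp) hx
  -- The normalization that gives b(x₀) = 1.
  set k : ℂ := Complex.exp (-(Complex.I * σ * x₀)) / evenPart x₁ α σ x₀ with hk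
  have hE : AbsolutelyContinuousOnInterval
      (fun x : ℝ => k * Complex.exp (Complex.I * σ * x)) x₀ x₁ := by
    refine ContDiffOn.absolutelyContinuousOnInterval (ContDiff.contDiffOn ?_)
    exact contDiff_const.mul (contDiff_const.mul Complex.ofRealCLM.contDiff).cexp
  have hEd : ∀ x : ℝ, HasDerivAt (fun x : ℝ => k * Complex.exp (Complex.I * σ * x))
      (Complex.I * σ * (k * Complex.exp (Complex.I * σ * x))) x := by
    intro x
    have := (((Complex.ofRealCLM.hasDerivAt (x := x)).const_mul (Complex.I * σ)).cexp).const_mul k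
    refine this.congr_deriv ?_
    simp
    ring
  set b : ℝ → ℂ := fun x => k * Complex.exp (Complex.I * σ * x) * evenPart x₁ α σ x with hb
  set a : ℝ → ℂ := fun x => k * Complex.exp (Complex.I * σ * x) * oddPart x₁ α σ x with ha
  have hbA : AbsolutelyContinuousOnInterval b x₀ x₁ := hE.smul c1
  have haA : AbsolutelyContinuousOnInterval a x₀ x₁ := hE.smul g1
  have hbc : ContinuousOn b (Icc x₀ x₁) := by
    rw [← uIcc_of_le hx]
    exact hbA.continuousOn
  have hac : ContinuousOn a (Icc x₀ x₁) := by
    rw [← uIcc_of_le hx]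
    exact haA.continuousOn
  have hsol : IsWaveSolution x₀ x₁ α σ a b := by
    refine ⟨hac, hbc, fun x hxm => ⟨?_, ?_⟩⟩
    · have := eq_add_integral_of_ae_hasDerivAt hx haA
        (IsWaveSolution.intervalIntegrable hα hx hac hbc (Complex.I * σ)).neg (by
          filter_upwards [g2] with t ht htm
          refine ((hEd t).mul (ht htm)).congr_deriv ?_
          simp only [Pi.neg_apply, ha, hb]
          ring) x hxm
      simp only [Pi.neg_apply] at this
      rw [this, intervalIntegral.integral_neg, ← sub_eq_add_neg]
    · have := eq_add_integral_of_ae_hasDerivAt hx hbA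
        (IsWaveSolution.intervalIntegrable' hα hx hac hbc (Complex.I * σ)).neg (by
          filter_upwards [c2] with t ht htm
          refine ((hEd t).mul (ht htm)).congr_deriv ?_
          simp only [Pi.neg_apply, ha, hb]
          ring) x hxm
      simp only [Pi.neg_apply] at this
      rw [this, intervalIntegral.integral_neg, ← sub_eq_add_neg]
  refine ⟨a, b, hsol, ?_, ?_, ?_⟩
  · simp only [hb, hk]
    rw [div_mul_eq_mul_div, ← Complex.exp_add, div_mul_cancel₀ _ hne]
    simp
  · simp [ha, oddPart_right hα]
  · simp only [hb, hk]
    rw [evenPart_right hα, Sech, Cosh_eq_evenPart hα _ hx, div_mul_eq_mul_div, ← Complex.exp_add,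
      mul_one, mul_one_div]
    congr 2
    ring

lemma isTransmittedAmplitude_iff (T : ℂ) : IsTransmittedAmplitude x₀ x₁ α σ T ↔
    T = Complex.exp (Complex.I * (x₁ - x₀) * σ) * Sech x₀ x₁ α (σ : ℂ) := by
  refine ⟨fun h => isTransmittedAmplitude_unique hα hx h (isTransmittedAmplitude_Sech hα hx), ?_⟩
  rintro rfl
  exact isTransmittedAmplitude_Sech hα hx

end Wave

/-! ### Cauchy's theorem and simple fractions on the real line. -/

open Complex in
/-- Cauchy's theorem on the upper half plane for functions of quadratic decay. -/
lemma integral_eq_zero_of_norm_le_inv_sq {F : ℂ → ℂ} (hc : ContinuousOn F {z | 0 ≤ z.im})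
    (hd : DifferentiableOn ℂ F {z | 0 < z.im}) {K R₀ : ℝ}
    (hb : ∀ z : ℂ, 0 ≤ z.im → R₀ ≤ ‖z‖ → ‖F z‖ ≤ K / ‖z‖ ^ 2) :
    ∫ x : ℝ, F x = 0 := by
  -- A nonintegrable function has integral 0 by convention, so integrability need not be assumed.
  by_cases hi : Integrable (fun x : ℝ => F x)
  swap
  · exact integral_undef hi
  have hlim : Tendsto (fun n : ℕ => ∫ x in (-(n : ℝ))..n, F x) atTop (𝓝 (∫ x : ℝ, F x)) :=
    intervalIntegral_tendsto_integral hi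
      (tendsto_neg_atTop_atBot.comp tendsto_natCast_atTop_atTop) tendsto_natCast_atTop_atTop
  refine tendsto_nhds_unique hlim ?_
  have hK : 0 ≤ K := by
    have h1 := hb ((max R₀ 1 : ℝ) * I) (by simp) (by
      rw [norm_mul, norm_I, mul_one, norm_real]
      exact (le_max_left _ _).trans (le_abs_self _))
    have h2 : 0 < ‖((max R₀ 1 : ℝ) * I : ℂ)‖ ^ 2 := by
      rw [norm_mul, norm_I, mul_one, norm_real, Real.norm_eq_abs, sq_abs]
      positivity
    by_contra h
    exact absurd ((norm_nonneg _).trans h1) (not_le.2 (div_neg_of_neg_of_pos (not_le.1 h) h2))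
  rw [tendsto_zero_iff_norm_tendsto_zero]
  have hz : Tendsto (fun n : ℕ => 4 * K / (n : ℝ)) atTop (𝓝 0) :=
    tendsto_const_nhds.div_atTop tendsto_natCast_atTop_atTop
  refine squeeze_zero' (Eventually.of_forall fun _ => norm_nonneg _) ?_ hz
  filter_upwards [eventually_ge_atTop (⌈max R₀ 1⌉₊)] with n hn
  have hnR : max R₀ 1 ≤ (n : ℝ) := Nat.ceil_le.1 hn
  have hn1 : (1 : ℝ) ≤ n := (le_max_right _ _).trans hnR
  have hn0 : R₀ ≤ (n : ℝ) := (le_max_left _ _).trans hnR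
  -- On the rectangle [-n, n] × [0, n], the three sides off the real axis have total length 4n and
  -- consist of points of modulus at least n, so they contribute at most 4K/n.
  have hrect := integral_boundary_rect_eq_zero_of_continuousOn_of_differentiableOn F
    (-(n : ℝ) : ℂ) ((n : ℝ) + (n : ℝ) * I) (by
      refine hc.mono fun z hz => ?_
      have := hz.2
      simp only [mem_preimage, neg_im, ofReal_im, neg_zero, add_im, mul_im, I_im, mul_one,
        I_re, mul_zero, add_zero, zero_add, ofReal_re] at this
      rw [uIcc_of_le (by linarith)] at this
      exact this.1) (by
      refine hd.mono fun z hz => ?_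
      have := hz.2
      simp only [mem_preimage, neg_im, ofReal_im, neg_zero, add_im, mul_im, I_im, mul_one,
        I_re, mul_zero, add_zero, zero_add, ofReal_re] at this
      rw [min_eq_left (by linarith)] at this
      exact this.1)
  simp only [neg_im, ofReal_im, neg_zero, add_im, mul_im, I_im, mul_one, neg_re, add_re, mul_re,
        I_re, mul_zero, add_zero, zero_add, ofReal_re, ofReal_zero, zero_mul, sub_zero] at hrect
  have hbound : ∀ z : ℂ, 0 ≤ z.im → (n : ℝ) ≤ ‖z‖ → ‖F z‖ ≤ K / (n : ℝ) ^ 2 := by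
    intro z hz1 hz2
    refine (hb z hz1 (hn0.trans hz2)).trans ?_
    gcongr
  have htop : ‖∫ x : ℝ in (-(n : ℝ))..n, F (x + (n : ℝ) * I)‖ ≤ K / (n : ℝ) ^ 2 * |(n : ℝ) - (-n)| := by
    refine intervalIntegral.norm_integral_le_of_norm_le_const fun x _ => hbound _ (by simp) ?_
    refine le_trans (le_of_eq ?_) (abs_im_le_norm _)
    simp
  have hside : ∀ c : ℝ, |c| = n →
      ‖∫ y : ℝ in (0 : ℝ)..n, F (c + y * I)‖ ≤ K / (n : ℝ) ^ 2 * |(n : ℝ) - 0| := by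
    intro c hcn
    refine intervalIntegral.norm_integral_le_of_norm_le_const fun y hy => ?_
    rw [uIoc_of_le (by linarith)] at hy
    refine hbound _ (by simpa using hy.1.le) ?_
    refine le_trans (le_of_eq ?_) (abs_re_le_norm _)
    simp [hcn]
  have hr := hside n (abs_of_nonneg (by linarith))
  have hl := hside (-n) (by rw [abs_neg, abs_of_nonneg (by linarith)])
  push_cast at hr hl htop hrect
  have heq : ∫ x : ℝ in (-(n : ℝ))..n, F x =
      (∫ x : ℝ in (-(n : ℝ))..n, F (x + (n : ℂ) * I)) -
        I * (∫ y : ℝ in (0 : ℝ)..n, F (n + y * I)) + I * ∫ y : ℝ in (0 : ℝ)..n, F (-n + y * I) := by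
    simp only [smul_eq_mul] at hrect
    linear_combination hrect
  rw [heq]
  have hI : ∀ z : ℂ, ‖I * z‖ = ‖z‖ := fun z => by rw [norm_mul, norm_I, one_mul]
  refine (norm_add_le _ _).trans ((add_le_add_left (norm_sub_le _ _) _).trans ?_)
  rw [hI, hI]
  have h4 : K / (n : ℝ) ^ 2 * |(n : ℝ) - (-n)| + K / (n : ℝ) ^ 2 * |(n : ℝ) - 0| +
      K / (n : ℝ) ^ 2 * |(n : ℝ) - 0| = 4 * K / n := by
    rw [sub_zero, abs_of_nonneg (by linarith : (0 : ℝ) ≤ n),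
      abs_of_nonneg (by linarith : (0 : ℝ) ≤ n - -n)]
    field_simp
    ring
  linarith

/-- The difference of two simple fractions. -/
def cauchyDiff (a b z : ℂ) : ℂ := 1 / (z - a) - 1 / (z - b)

lemma norm_cauchyDiff_le {a b z : ℂ} (ha : 2 * ‖a‖ ≤ ‖z‖) (hb : 2 * ‖b‖ ≤ ‖z‖) (hz : 0 < ‖z‖) :
    ‖cauchyDiff a b z‖ ≤ 4 * ‖a - b‖ / ‖z‖ ^ 2 := by
  have h1 : ∀ c : ℂ, 2 * ‖c‖ ≤ ‖z‖ → ‖z‖ / 2 ≤ ‖z - c‖ := by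
    intro c hc
    have := norm_sub_norm_le z c
    linarith
  have hza : 0 < ‖z - a‖ := lt_of_lt_of_le (by positivity) (h1 a ha)
  have hzb : 0 < ‖z - b‖ := lt_of_lt_of_le (by positivity) (h1 b hb)
  have h2 : cauchyDiff a b z = (a - b) / ((z - a) * (z - b)) := by
    have := norm_pos_iff.1 hza
    have := norm_pos_iff.1 hzb
    unfold cauchyDiff
    field_simp
    ring
  rw [h2, norm_div, norm_mul]
  calc ‖a - b‖ / (‖z - a‖ * ‖z - b‖) ≤ ‖a - b‖ / (‖z‖ / 2 * (‖z‖ / 2)) := by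
        gcongr
        · exact h1 a ha
        · exact h1 b hb
    _ = _ := by field_simp; ring

lemma integrable_inv_norm_sub_sq {a : ℂ} (ha : a.im ≠ 0) :
    Integrable (fun s : ℝ => (‖(s : ℂ) - a‖ ^ 2)⁻¹) := by
  have h1 := (integrable_inv_one_add_sq.comp_mul_left' (inv_ne_zero ha)).comp_sub_right a.re
  refine (h1.const_mul ((a.im ^ 2)⁻¹)).congr (Eventually.of_forall fun s => ?_)
  simp only
  rw [← Complex.normSq_eq_norm_sq, Complex.normSq_apply]
  simp
  field_simp
  ring

lemma ofReal_sub_ne_zero {a : ℂ} (ha : a.im ≠ 0) (s : ℝ) : (s : ℂ) - a ≠ 0 := by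
  intro h
  apply ha
  have := congrArg Complex.im h
  simpa using this

lemma continuous_cauchyDiff {a b : ℂ} (ha : a.im ≠ 0) (hb : b.im ≠ 0) :
    Continuous (fun s : ℝ => cauchyDiff a b s) := by
  unfold cauchyDiff
  exact (continuous_const.div (by fun_prop) (ofReal_sub_ne_zero ha)).sub
    (continuous_const.div (by fun_prop) (ofReal_sub_ne_zero hb))

lemma integrable_cauchyDiff {a b : ℂ} (ha : a.im ≠ 0) (hb : b.im ≠ 0) :
    Integrable (fun s : ℝ => cauchyDiff a b s) := by
  refine (((integrable_inv_norm_sub_sq ha).add (integrable_inv_norm_sub_sq hb)).const_mul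
    ‖a - b‖).mono' (continuous_cauchyDiff ha hb).aestronglyMeasurable
    (Eventually.of_forall fun s => ?_)
  have h1 := ofReal_sub_ne_zero ha s
  have h2 := ofReal_sub_ne_zero hb s
  have h3 : cauchyDiff a b s = (a - b) * (((s : ℂ) - a)⁻¹ * ((s : ℂ) - b)⁻¹) := by
    unfold cauchyDiff
    field_simp
    ring
  rw [h3, norm_mul, norm_mul, norm_inv, norm_inv]
  simp only [Pi.add_apply]
  gcongr
  rw [← inv_pow, ← inv_pow]
  nlinarith [sq_nonneg (‖(s : ℂ) - a‖⁻¹ - ‖(s : ℂ) - b‖⁻¹), sq_nonneg (‖(s : ℂ) - a‖⁻¹),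
    sq_nonneg (‖(s : ℂ) - b‖⁻¹)]

/-- This difference is 2πi times the Poisson kernel of a; an affine substitution reduces its
integral to that of 1/(1 + s²). -/
lemma integral_cauchyDiff_conj {a : ℂ} (ha : 0 < a.im) :
    ∫ s : ℝ, cauchyDiff a (starRingEnd ℂ a) s = 2 * Real.pi * Complex.I := by
  have h1 : ∀ s : ℝ, cauchyDiff a (starRingEnd ℂ a) s =
      ((2 * (a.im)⁻¹ * (1 + (a.im⁻¹ * (s - a.re)) ^ 2)⁻¹ : ℝ) : ℂ) * Complex.I := by
    intro s
    have e1 := ofReal_sub_ne_zero ha.ne' s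
    have e2 : (s : ℂ) - starRingEnd ℂ a ≠ 0 := ofReal_sub_ne_zero (by simpa using ha.ne') s
    have e3 : ((s : ℂ) - a) * ((s : ℂ) - starRingEnd ℂ a) = (((s - a.re) ^ 2 + a.im ^ 2 : ℝ) : ℂ) := by
      apply Complex.ext <;> simp [-Complex.ofReal_add, -Complex.ofReal_pow, -Complex.ofReal_sub] <;> ring
    have e4 : a - starRingEnd ℂ a = ((2 * a.im : ℝ) : ℂ) * Complex.I := Complex.sub_conj a
    have e5 : cauchyDiff a (starRingEnd ℂ a) s =
        (a - starRingEnd ℂ a) / (((s : ℂ) - a) * ((s : ℂ) - starRingEnd ℂ a)) := by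
      unfold cauchyDiff
      field_simp
      ring
    rw [e5, e3, e4, mul_div_right_comm, ← Complex.ofReal_div]
    congr 2
    have : (s - a.re) ^ 2 + a.im ^ 2 ≠ 0 := by positivity
    have : 1 + (a.im⁻¹ * (s - a.re)) ^ 2 ≠ 0 := by positivity
    field_simp
    ring
  simp_rw [h1]
  rw [integral_mul_const, integral_complex_ofReal, integral_const_mul,
    integral_sub_right_eq_self (fun s => (1 + (a.im⁻¹ * s) ^ 2)⁻¹) a.re,
    Measure.integral_comp_mul_left (fun s => (1 + s ^ 2)⁻¹) a.im⁻¹, integral_univ_inv_one_add_sq]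
  rw [inv_inv, abs_of_pos ha, smul_eq_mul]
  have : 2 * a.im⁻¹ * (a.im * Real.pi) = 2 * Real.pi := by field_simp
  rw [this]
  push_cast
  ring

/-! ### Poisson and Schwarz formulas for bounded holomorphic functions. -/

section Bounded

variable {h : ℂ → ℂ} {M : ℝ} (hc : ContinuousOn h {z | 0 ≤ z.im})
  (hd : DifferentiableOn ℂ h {z | 0 < z.im}) (hM : ∀ z : ℂ, 0 ≤ z.im → ‖h z‖ ≤ M)

include hc in
lemma continuous_restrict_real : Continuous (fun s : ℝ => h s) :=
  hc.comp_continuous Complex.continuous_ofReal (fun s => by simp)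

include hc hM in
lemma integrable_mul_cauchyDiff {a b : ℂ} (ha : a.im ≠ 0) (hb : b.im ≠ 0) :
    Integrable (fun s : ℝ => h s * cauchyDiff a b s) :=
  (integrable_cauchyDiff ha hb).bdd_mul (continuous_restrict_real hc).aestronglyMeasurable
    (Eventually.of_forall fun s => hM s (by simp))

-- Both poles lie below the real line, and the difference of the two fractions decays quadratically.
include hc hd hM in
lemma integral_mul_cauchyDiff_lower {a b : ℂ} (ha : a.im < 0) (hb : b.im < 0) :
    ∫ s : ℝ, h s * cauchyDiff a b s = 0 := by
  have hne : ∀ c : ℂ, c.im < 0 → ∀ z : ℂ, 0 ≤ z.im → z - c ≠ 0 := by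
    intro c hc z hz h0
    rw [sub_eq_zero.1 h0] at hz
    linarith
  have hM0 : 0 ≤ M := (norm_nonneg _).trans (hM 0 (by simp))
  refine integral_eq_zero_of_norm_le_inv_sq (F := fun z => h z * cauchyDiff a b z)
    (K := M * (4 * ‖a - b‖)) (R₀ := 2 * ‖a‖ + 2 * ‖b‖ + 1) ?_ ?_ ?_
  · refine hc.mul (ContinuousOn.sub ?_ ?_) <;>
      refine continuousOn_const.div (by fun_prop) fun z hz => hne _ ‹_› z hz
  · refine hd.mul (DifferentiableOn.sub ?_ ?_) <;>
      refine (differentiableOn_const _).div (by fun_prop) fun z hz => hne _ ‹_› z (le_of_lt hz)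
  · intro z hz hR
    rw [norm_mul, mul_div_assoc]
    have := norm_nonneg a
    have := norm_nonneg b
    exact mul_le_mul (hM z hz) (norm_cauchyDiff_le (by linarith) (by linarith) (by linarith))
      (norm_nonneg _) hM0

include hc hd hM in
/-- The Poisson formula for a bounded holomorphic function on the upper half plane. -/
lemma integral_mul_cauchyDiff_conj {a : ℂ} (ha : 0 < a.im) :
    ∫ s : ℝ, h s * cauchyDiff a (starRingEnd ℂ a) s = 2 * Real.pi * Complex.I * h a := by
  have hca : (starRingEnd ℂ a).im < 0 := by simpa using ha
  have hU : {z : ℂ | 0 < z.im} ∈ 𝓝 a :=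
    (isOpen_lt continuous_const Complex.continuous_im).mem_nhds ha
  have hne : ∀ z : ℂ, 0 ≤ z.im → z - starRingEnd ℂ a ≠ 0 := by
    intro z hz h0
    rw [sub_eq_zero.1 h0] at hz
    linarith
  have hM0 : 0 ≤ M := (norm_nonneg _).trans (hM 0 (by simp))
  -- Subtracting h(a) makes the pole at a removable, and `dslope` fills in the value there. Away
  -- from a, F is (h - h(a)) times the difference of fractions, so Cauchy's theorem applies without
  -- residues.
  set F : ℂ → ℂ := fun z => dslope h a z - (h z - h a) / (z - starRingEnd ℂ a) with hF
  have hFe : ∀ z, z ≠ a → F z = (h z - h a) * cauchyDiff a (starRingEnd ℂ a) z := by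
    intro z hz
    rw [hF]
    simp only
    rw [dslope_of_ne _ hz, slope_def_field, cauchyDiff]
    ring
  have h0 : ∫ s : ℝ, F s = 0 := by
    refine integral_eq_zero_of_norm_le_inv_sq
      (K := (2 * M) * (4 * ‖a - starRingEnd ℂ a‖))
      (R₀ := 2 * ‖a‖ + 2 * ‖starRingEnd ℂ a‖ + 1) ?_ ?_ ?_
    · refine ContinuousOn.sub ?_ ((hc.sub continuousOn_const).div (by fun_prop) fun z hz => hne z hz)
      have hs : {z : ℂ | 0 ≤ z.im} ∈ 𝓝 a :=
        mem_of_superset hU fun z hz => le_of_lt (show 0 < z.im from hz)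
      exact (continuousOn_dslope hs).2
        ⟨hc, hd.differentiableAt hU⟩
    · refine DifferentiableOn.sub ?_ ((hd.sub_const _).div (by fun_prop)
        fun z hz => hne z (le_of_lt hz))
      exact (Complex.differentiableOn_dslope hU).2 hd
    · intro z hz hR
      have := norm_nonneg a
      have := norm_nonneg (starRingEnd ℂ a)
      have hza : z ≠ a := by
        rintro rfl
        linarith
      rw [hFe z hza, norm_mul, mul_div_assoc]
      refine mul_le_mul ?_ (norm_cauchyDiff_le (by linarith) (by linarith) (by linarith))
        (norm_nonneg _) (by linarith)
      exact (norm_sub_le _ _).trans (by linarith [hM z hz, hM a ha.le])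
  have h1 : ∀ s : ℝ, F s = h s * cauchyDiff a (starRingEnd ℂ a) s -
      h a * cauchyDiff a (starRingEnd ℂ a) s := by
    intro s
    rw [hFe s (by
      rintro h0
      rw [← h0] at ha
      simp at ha)]
    ring
  simp_rw [h1] at h0
  rw [integral_sub (integrable_mul_cauchyDiff hc hM ha.ne' hca.ne)
    ((integrable_cauchyDiff ha.ne' hca.ne).const_mul _), integral_const_mul,
    integral_cauchyDiff_conj ha] at h0
  linear_combination h0

/-- The kernel is 1/(s - σ) minus the mean of 1/(s - i) and 1/(s + i). It is grouped into
differences, each integrable and each covered by one of the two preceding integral formulas. -/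
lemma schwarz_kernel_eq {σ : ℂ} (hσ : 0 < σ.im) (s : ℝ) :
    (1 + (s : ℂ) * σ) / ((s : ℂ) - σ) / (1 + (s : ℂ) ^ 2) =
      cauchyDiff σ (starRingEnd ℂ σ) s - cauchyDiff Complex.I (-Complex.I) s / 2 +
        cauchyDiff (starRingEnd ℂ σ) (-Complex.I) s := by
  have e1 := ofReal_sub_ne_zero hσ.ne' s
  have e3 := ofReal_sub_ne_zero (a := Complex.I) (by simp) s
  have e4 := ofReal_sub_ne_zero (a := -Complex.I) (by simp) s
  have e5 : 1 + (s : ℂ) ^ 2 = (s - Complex.I) * (s - -Complex.I) := by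
    linear_combination Complex.I_mul_I
  have e6 : cauchyDiff σ (starRingEnd ℂ σ) s - cauchyDiff Complex.I (-Complex.I) s / 2 +
        cauchyDiff (starRingEnd ℂ σ) (-Complex.I) s = 1 / (s - σ) -
        (1 / (s - Complex.I) + 1 / (s - -Complex.I)) / 2 := by
    unfold cauchyDiff
    ring
  rw [e6, div_div, div_eq_iff (mul_ne_zero e1 (by rw [e5]; exact mul_ne_zero e3 e4)), e5]
  field_simp
  linear_combination (2 : ℂ) * Complex.I_mul_I

lemma conj_cauchyDiff (a b : ℂ) (s : ℝ) :
    starRingEnd ℂ (cauchyDiff a b s) = cauchyDiff (starRingEnd ℂ a) (starRingEnd ℂ b) s := by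
  simp [cauchyDiff]

include hc hd hM in
/-- The Schwarz integral formula on the upper half plane. -/
lemma schwarz_integral_formula (hI : (h Complex.I).im = 0) {σ : ℂ} (hσ : 0 < σ.im) :
    ∫ s : ℝ, (1 + (s : ℂ) * σ) / ((s : ℂ) - σ) * ((h s).re : ℂ) / (1 + (s : ℂ) ^ 2) =
      Complex.I * Real.pi * h σ := by
  have hcσ : (starRingEnd ℂ σ).im < 0 := by simpa using hσ
  have hnI : (-Complex.I).im < 0 := by simp
  have hI0 : 0 < Complex.I.im := by simp
  have hcI : starRingEnd ℂ Complex.I = -Complex.I := Complex.conj_I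
  have i1 := integrable_mul_cauchyDiff hc hM hσ.ne' hcσ.ne
  have i2 := integrable_mul_cauchyDiff hc hM hI0.ne' hnI.ne
  have i3 := integrable_mul_cauchyDiff hc hM hcσ.ne hnI.ne
  have v1 := integral_mul_cauchyDiff_conj hc hd hM hσ
  have v2 := integral_mul_cauchyDiff_conj hc hd hM hI0
  have v3 := integral_mul_cauchyDiff_lower hc hd hM hcσ hnI
  rw [hcI] at v2
  -- Write Re h as (h + h̄)/2. In the h̄ term the conjugate is pulled outside, which replaces the
  -- kernel by its conjugate, whose σ pole lies in the lower half plane.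
  have hre : ∀ s : ℝ, (1 + (s : ℂ) * σ) / ((s : ℂ) - σ) * ((h s).re : ℂ) / (1 + (s : ℂ) ^ 2) =
      (h s * cauchyDiff σ (starRingEnd ℂ σ) s - h s * cauchyDiff Complex.I (-Complex.I) s / 2 +
        h s * cauchyDiff (starRingEnd ℂ σ) (-Complex.I) s) / 2 +
      starRingEnd ℂ (h s * cauchyDiff (starRingEnd ℂ σ) (-Complex.I) s -
        h s * cauchyDiff Complex.I (-Complex.I) s / 2) / 2 := by
    intro s
    have k1 : cauchyDiff (starRingEnd ℂ (starRingEnd ℂ σ)) (starRingEnd ℂ (-Complex.I)) s -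
        cauchyDiff (starRingEnd ℂ Complex.I) (starRingEnd ℂ (-Complex.I)) s / 2 =
        cauchyDiff σ (starRingEnd ℂ σ) s - cauchyDiff Complex.I (-Complex.I) s / 2 +
        cauchyDiff (starRingEnd ℂ σ) (-Complex.I) s := by
      simp only [cauchyDiff, map_neg, Complex.conj_I, neg_neg, Complex.conj_conj]
      ring
    have k2 : ((h s).re : ℂ) = (h s + starRingEnd ℂ (h s)) / 2 := Complex.re_eq_add_conj _
    rw [mul_div_right_comm, schwarz_kernel_eq hσ, k2]
    rw [map_sub, map_div₀, map_mul, map_mul, conj_cauchyDiff, conj_cauchyDiff]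
    have k3 : starRingEnd ℂ (2 : ℂ) = 2 := map_ofNat _ 2
    rw [k3]
    linear_combination (-starRingEnd ℂ (h s) / 2) * k1
  simp_rw [hre]
  have i12 : Integrable (fun s : ℝ => h s * cauchyDiff σ (starRingEnd ℂ σ) s -
      h s * cauchyDiff Complex.I (-Complex.I) s / 2) := i1.sub (i2.div_const 2)
  have j1 : Integrable (fun s : ℝ => (h s * cauchyDiff σ (starRingEnd ℂ σ) s -
      h s * cauchyDiff Complex.I (-Complex.I) s / 2 +
        h s * cauchyDiff (starRingEnd ℂ σ) (-Complex.I) s) / 2) :=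
    (i12.add i3).div_const 2
  have j0 : Integrable (fun s : ℝ => h s * cauchyDiff (starRingEnd ℂ σ) (-Complex.I) s -
        h s * cauchyDiff Complex.I (-Complex.I) s / 2) := i3.sub (i2.div_const 2)
  have j2 : Integrable (fun s : ℝ => starRingEnd ℂ (h s * cauchyDiff (starRingEnd ℂ σ)
      (-Complex.I) s - h s * cauchyDiff Complex.I (-Complex.I) s / 2) / 2) :=
    (Complex.conjCLE.toContinuousLinearMap.integrable_comp j0).div_const 2
  rw [integral_add j1 j2, integral_div, integral_div, integral_add i12 i3,
    integral_sub i1 (i2.div_const 2), integral_div, v1, v2, v3, integral_conj,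
    integral_sub i3 (i2.div_const 2), integral_div, v2, v3]
  -- The two halves contribute -πi h(i) and πi times the conjugate of h(i); these cancel because
  -- h(i) is real.
  have hIr : starRingEnd ℂ (h Complex.I) = h Complex.I := Complex.conj_eq_iff_im.2 hI
  simp only [map_sub, map_zero, map_div₀, map_mul, Complex.conj_I, hIr, Complex.conj_ofReal,
    map_ofNat]
  ring

end Bounded

/-! ### Fourier transforms of tempered distributions given by functions. -/

section Distribution

lemma exists_hasFourierTransform {f : ℝ → ℂ} (hf : Continuous f) {C : ℝ} (hC : ∀ s, ‖f s‖ ≤ C) :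
    ∃ τ : 𝓢'(ℝ, ℂ), HasFourierTransform τ f := by
  have hg : Continuous (fun ξ : ℝ => f (2 * Real.pi * ξ)) := by fun_prop
  have hm : MemLp (fun ξ : ℝ => f (2 * Real.pi * ξ)) ⊤ volume :=
    memLp_top_of_bound hg.aestronglyMeasurable C (Eventually.of_forall fun ξ => hC _)
  refine ⟨𝓕 (hm.toLp _ : 𝓢'(ℝ, ℂ)), fun φ => ⟨?_, ?_⟩⟩
  · exact φ.integrable.mul_bdd hg.aestronglyMeasurable (Eventually.of_forall fun ξ => hC _)
  · rw [FourierTransform.fourierInv_fourier_eq, Lp.toTemperedDistribution_apply]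
    refine integral_congr_ae ?_
    filter_upwards [hm.coeFn_toLp] with ξ h
    rw [h, smul_eq_mul]

lemma HasFourierTransform.unique {τ τ' : 𝓢'(ℝ, ℂ)} {f : ℝ → ℂ} (h : HasFourierTransform τ f)
    (h' : HasFourierTransform τ' f) : τ = τ' := by
  have h1 : 𝓕⁻ τ = 𝓕⁻ τ' := by
    ext φ
    rw [(h φ).2, (h' φ).2]
  have h2 : ∀ ρ : 𝓢'(ℝ, ℂ), 𝓕 (𝓕⁻ ρ : 𝓢'(ℝ, ℂ)) = ρ := FourierTransform.fourier_fourierInv_eq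
  rw [← h2 τ, h1, h2]

lemma exists_schwartzMap_eq {g : ℝ → ℝ} (hg : ContDiff ℝ (⊤ : ℕ∞) g) (hc : HasCompactSupport g) :
    ∃ φ : 𝓢(ℝ, ℂ), ∀ x, φ x = (g x : ℂ) := by
  have hg₁ : HasCompactSupport (Complex.ofRealCLM ∘ g) := hc.comp_left rfl
  have hg₂ : ContDiff ℝ (⊤ : ℕ∞) (Complex.ofRealCLM ∘ g) := by fun_prop
  exact ⟨hg₁.toSchwartzMap hg₂, fun x => by simp⟩

/-- Testing against a bump function that equals 1 near the point gives integrability there. -/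
lemma HasFourierTransform.locallyIntegrable {τ : 𝓢'(ℝ, ℂ)} {f : ℝ → ℂ}
    (h : HasFourierTransform τ f) : LocallyIntegrable (fun ξ : ℝ => f (2 * Real.pi * ξ)) := by
  intro x
  let g : ContDiffBump x := ⟨1, 2, one_pos, one_lt_two⟩
  obtain ⟨φ, hφ⟩ := exists_schwartzMap_eq (g := g) g.contDiff g.hasCompactSupport
  refine ⟨Metric.closedBall x 1, Metric.closedBall_mem_nhds x one_pos, ?_⟩
  refine ((h φ).1.integrableOn (s := Metric.closedBall x 1)).congr_fun (fun ξ hξ => ?_)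
    Metric.isClosed_closedBall.measurableSet
  simp only
  rw [hφ, g.one_of_mem_closedBall hξ, Complex.ofReal_one, one_mul]

lemma HasFourierTransform.ae_eq {τ : 𝓢'(ℝ, ℂ)} {f g : ℝ → ℂ}
    (hf : HasFourierTransform τ f) (hg : HasFourierTransform τ g) :
    ∀ᵐ ξ : ℝ, f (2 * Real.pi * ξ) = g (2 * Real.pi * ξ) := by
  refine ae_eq_of_integral_contDiff_smul_eq hf.locallyIntegrable hg.locallyIntegrable
    fun ψ hψ hc => ?_
  obtain ⟨φ, hφ⟩ := exists_schwartzMap_eq hψ hc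
  have h := (hf φ).2.symm.trans (hg φ).2
  simpa only [hφ, Complex.real_smul] using h

lemma IsPowerSpectrum.ae_eq {τ : 𝓢'(ℝ, ℂ)} {f : ℝ → ℂ} {P : ℝ → ℝ} (hP : IsPowerSpectrum τ P)
    (hf : HasFourierTransform τ f) :
    ∀ᵐ ξ : ℝ, P (2 * Real.pi * ξ) = ‖f (2 * Real.pi * ξ)‖ ^ 2 := by
  obtain ⟨g, hg, hPg⟩ := hP
  -- Dilation by 2π pulls null sets back to null sets, so an almost everywhere statement in σ
  -- carries over to ξ.
  have hq : Measure.QuasiMeasurePreserving (fun ξ : ℝ => 2 * Real.pi * ξ) := by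
    refine ⟨by fun_prop, ?_⟩
    rw [Real.map_volume_mul_left (by positivity)]
    exact Measure.smul_absolutelyContinuous
  filter_upwards [hq.ae hPg, hg.ae_eq hf] with ξ h1 h2
  rw [h1, h2]

end Distribution

/-! ### Assembly: `Sech`, transmission data and their power spectrum. -/

section Secant

variable {α : ℝ → ℝ} {x₀ x₁ : ℝ}

lemma Cosh_congr {β : ℝ → ℝ} (h : EqOn α β (Ioo x₀ x₁)) : Cosh x₀ x₁ α = Cosh x₀ x₁ β := by
  have h' : EqOn (-α) (-β) (Ioo x₀ x₁) := fun x hx => congrArg Neg.neg (h hx)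
  ext σ
  simp only [Cosh, hexp, hexpTerm_congr h, hexpTerm_congr h']

lemma Sech_congr {β : ℝ → ℝ} (h : EqOn α β (Ioo x₀ x₁)) : Sech x₀ x₁ α = Sech x₀ x₁ β := by
  ext σ
  rw [Sech, Sech, Cosh_congr h]

lemma exists_integrable_eqOn (hα : IntegrableOn α (Ioo x₀ x₁)) :
    ∃ β : ℝ → ℝ, Integrable β ∧ EqOn α β (Ioo x₀ x₁) :=
  ⟨(Ioo x₀ x₁).indicator α, (integrable_indicator_iff measurableSet_Ioo).2 hα,
    fun _ hx => (indicator_of_mem hx α).symm⟩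

variable (hα : IntegrableOn α (Ioo x₀ x₁)) (hX : x₀ ≤ x₁)
include hα hX

lemma one_le_norm_Cosh {σ : ℂ} (hσ : 0 ≤ σ.im) : 1 ≤ ‖Cosh x₀ x₁ α σ‖ := by
  obtain ⟨β, hβ, h⟩ := exists_integrable_eqOn hα
  rw [Cosh_congr h, Cosh_eq_evenPart hβ σ hX]
  exact one_le_norm_evenPart hβ hσ hX

lemma Cosh_ne_zero {σ : ℂ} (hσ : 0 ≤ σ.im) : Cosh x₀ x₁ α σ ≠ 0 :=
  norm_pos_iff.1 (lt_of_lt_of_le one_pos (one_le_norm_Cosh hα hX hσ))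

lemma norm_Sech_le_one {σ : ℂ} (hσ : 0 ≤ σ.im) : ‖Sech x₀ x₁ α σ‖ ≤ 1 := by
  rw [Sech, norm_div, norm_one]
  exact div_le_one_of_le₀ (one_le_norm_Cosh hα hX hσ) (norm_nonneg _)

lemma differentiable_Cosh : Differentiable ℂ (Cosh x₀ x₁ α) := by
  obtain ⟨β, hβ, h⟩ := exists_integrable_eqOn hα
  have : Cosh x₀ x₁ α = fun σ => evenPart x₁ β σ x₀ := by
    ext σ
    rw [Cosh_congr h, Cosh_eq_evenPart hβ σ hX]
  rw [this]
  exact differentiable_evenPart hβ hX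

lemma analyticOnNhd_Sech : AnalyticOnNhd ℂ (Sech x₀ x₁ α) {σ : ℂ | 0 ≤ σ.im} := fun σ hσ =>
  analyticAt_const.div ((differentiable_Cosh hα hX).analyticAt σ) (Cosh_ne_zero hα hX hσ)

/-- A bounded holomorphic logarithm of `Sech` on the closed upper half plane. -/
lemma exists_log_Sech : ∃ (h : ℂ → ℂ) (M : ℝ), ContinuousOn h {σ | 0 ≤ σ.im} ∧
    DifferentiableOn ℂ h {σ | 0 < σ.im} ∧ (∀ σ : ℂ, 0 ≤ σ.im → ‖h σ‖ ≤ M) ∧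
    (h Complex.I).im = 0 ∧ ∀ σ : ℂ, 0 ≤ σ.im → Complex.exp (h σ) = Sech x₀ x₁ α σ := by
  obtain ⟨β, hβ, h⟩ := exists_integrable_eqOn hα
  rw [Sech_congr h]
  exact ⟨logSech x₀ x₁ β, ∫ x, |β x|, continuousOn_logSech hβ hX, differentiableOn_logSech hβ hX,
    fun _ => norm_logSech_le hβ, logSech_I_im, fun _ => exp_logSech hβ hX⟩

lemma integrable_log_norm_Sech :
    Integrable (fun s : ℝ => Real.log ‖Sech x₀ x₁ α (s : ℂ)‖ / (1 + s ^ 2)) := by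
  obtain ⟨h, M, hc, -, hM, -, he⟩ := exists_log_Sech hα hX
  have hlog : ∀ s : ℝ, Real.log ‖Sech x₀ x₁ α (s : ℂ)‖ = (h s).re := fun s => by
    rw [← he s (by simp), Complex.norm_exp, Real.log_exp]
  simp_rw [hlog, div_eq_mul_inv]
  refine integrable_inv_one_add_sq.bdd_mul (c := M)
    (Complex.continuous_re.comp (continuous_restrict_real hc)).aestronglyMeasurable
    (Eventually.of_forall fun s => ?_)
  exact (Complex.abs_re_le_norm _).trans (hM s (by simp))

lemma Sech_eq_outerExp {σ : ℂ} (hσ : 0 < σ.im) : Sech x₀ x₁ α σ =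
    outerExp (fun s : ℝ => Real.log ‖Sech x₀ x₁ α (s : ℂ)‖) σ := by
  obtain ⟨h, M, hc, hd, hM, hI, he⟩ := exists_log_Sech hα hX
  have hlog : ∀ s : ℝ, Real.log ‖Sech x₀ x₁ α (s : ℂ)‖ = (h s).re := fun s => by
    rw [← he s (by simp), Complex.norm_exp, Real.log_exp]
  simp_rw [outerExp, hlog]
  rw [schwarz_integral_formula hc hd hM hI hσ, ← he σ hσ.le]
  have : (Real.pi : ℂ) ≠ 0 := Complex.ofReal_ne_zero.2 Real.pi_ne_zero
  congr 1
  field_simp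

/-- The outer exponential agrees with `Sech` in the open half plane, and `Sech` is analytic at real
points; no boundary analysis of the integral is needed. -/
lemma tendsto_outerExp_Sech (r : ℝ) :
    Tendsto (outerExp (fun s : ℝ => Real.log ‖Sech x₀ x₁ α (s : ℂ)‖))
      (𝓝[{σ : ℂ | 0 < σ.im}] (r : ℂ)) (𝓝 (Sech x₀ x₁ α (r : ℂ))) := by
  have h := (analyticOnNhd_Sech hα hX (r : ℂ) (by simp)).continuousAt.continuousWithinAt
    (s := {σ : ℂ | 0 < σ.im})
  refine h.tendsto.congr' ?_
  filter_upwards [self_mem_nhdsWithin] with σ hσ using Sech_eq_outerExp hα hX hσ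

lemma isTransmittedAmplitude_iff_of_integrableOn (s : ℝ) (T : ℂ) :
    IsTransmittedAmplitude x₀ x₁ α s T ↔
      T = Complex.exp (Complex.I * (x₁ - x₀) * s) * Sech x₀ x₁ α (s : ℂ) := by
  obtain ⟨β, hβ, h⟩ := exists_integrable_eqOn hα
  rw [Sech_congr h, ← isTransmittedAmplitude_iff hβ hX]
  constructor
  · rintro ⟨a, b, hs, hab⟩
    exact ⟨a, b, isWaveSolution_congr h hs, hab⟩
  · rintro ⟨a, b, hs, hab⟩
    exact ⟨a, b, isWaveSolution_congr h.symm hs, hab⟩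

omit hα hX in
/-- The amplitude transmitted across `(x₀, x₁)` as a function of the frequency. -/
def transmission (x₀ x₁ : ℝ) (α : ℝ → ℝ) (s : ℝ) : ℂ :=
  Complex.exp (Complex.I * (x₁ - x₀) * s) * Sech x₀ x₁ α (s : ℂ)

omit hα hX in
lemma norm_transmission (s : ℝ) : ‖transmission x₀ x₁ α s‖ = ‖Sech x₀ x₁ α (s : ℂ)‖ := by
  have : Complex.I * (x₁ - x₀) * s = (((x₁ - x₀) * s : ℝ) : ℂ) * Complex.I := by
    push_cast
    ring
  rw [transmission, norm_mul, this, Complex.norm_exp_ofReal_mul_I, one_mul]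

lemma continuous_transmission : Continuous (transmission x₀ x₁ α) := by
  have : Continuous fun s : ℝ => Sech x₀ x₁ α (s : ℂ) :=
    (analyticOnNhd_Sech hα hX).continuousOn.comp_continuous Complex.continuous_ofReal
      (fun s => by simp)
  unfold transmission
  fun_prop

lemma isTransmissionData_iff (τ : 𝓢'(ℝ, ℂ)) :
    IsTransmissionData x₀ x₁ α τ ↔ HasFourierTransform τ (transmission x₀ x₁ α) := by
  simp only [IsTransmissionData, isTransmittedAmplitude_iff_of_integrableOn hα hX]
  constructor
  · rintro ⟨T, hT, h⟩
    rwa [show T = transmission x₀ x₁ α from funext hT] at h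
  · exact fun h => ⟨_, fun _ => rfl, h⟩

lemma existsUnique_isTransmissionData : ∃! τ : 𝓢'(ℝ, ℂ), IsTransmissionData x₀ x₁ α τ := by
  simp only [isTransmissionData_iff hα hX]
  obtain ⟨τ, hτ⟩ := exists_hasFourierTransform (continuous_transmission hα hX) (C := 1) fun s => by
    rw [norm_transmission]
    exact norm_Sech_le_one hα hX (by simp)
  exact ⟨τ, hτ, fun τ' h => HasFourierTransform.unique h hτ⟩

lemma isPowerSpectrum_of_isTransmissionData {τ : 𝓢'(ℝ, ℂ)} (h : IsTransmissionData x₀ x₁ α τ) :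
    IsPowerSpectrum τ fun s : ℝ => ‖Sech x₀ x₁ α (s : ℂ)‖ ^ 2 :=
  ⟨_, (isTransmissionData_iff hα hX τ).1 h, Eventually.of_forall fun s => by rw [norm_transmission]⟩

lemma norm_Sech_eq_of_isPowerSpectrum {y₀ y₁ : ℝ} {β : ℝ → ℝ} (hβ : IntegrableOn β (Ioo y₀ y₁))
    (hY : y₀ ≤ y₁) {τ τ' : 𝓢'(ℝ, ℂ)} {P : ℝ → ℝ} (h : IsTransmissionData x₀ x₁ α τ)
    (h' : IsTransmissionData y₀ y₁ β τ') (hP : IsPowerSpectrum τ P) (hP' : IsPowerSpectrum τ' P)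
    (s : ℝ) : ‖Sech x₀ x₁ α (s : ℂ)‖ = ‖Sech y₀ y₁ β (s : ℂ)‖ := by
  have c1 := continuous_transmission hα hX
  have c2 := continuous_transmission hβ hY
  have hae : (fun ξ : ℝ => ‖transmission x₀ x₁ α (2 * Real.pi * ξ)‖) =ᵐ[volume]
      fun ξ : ℝ => ‖transmission y₀ y₁ β (2 * Real.pi * ξ)‖ := by
    filter_upwards [hP.ae_eq ((isTransmissionData_iff hα hX τ).1 h),
      hP'.ae_eq ((isTransmissionData_iff hβ hY τ').1 h')] with ξ h1 h2
    exact (sq_eq_sq₀ (norm_nonneg _) (norm_nonneg _)).1 (h1.symm.trans h2)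
  -- Both moduli are continuous, so equality almost everywhere is equality everywhere.
  have heq := congrFun ((Continuous.ae_eq_iff_eq volume (by fun_prop) (by fun_prop)).1 hae)
    ((2 * Real.pi)⁻¹ * s)
  have hs : 2 * Real.pi * ((2 * Real.pi)⁻¹ * s) = s := mul_inv_cancel_left₀ (by positivity) s
  simpa only [hs, norm_transmission] using heq

/-- The outer exponential depends only on the modulus on the real line, so both functions are
boundary values of the same function. -/
lemma Sech_ofReal_eq_of_norm_eq {y₀ y₁ : ℝ} {β : ℝ → ℝ} (hβ : IntegrableOn β (Ioo y₀ y₁))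
    (hY : y₀ ≤ y₁) (h : ∀ s : ℝ, ‖Sech x₀ x₁ α (s : ℂ)‖ = ‖Sech y₀ y₁ β (s : ℂ)‖) (r : ℝ) :
    Sech x₀ x₁ α (r : ℂ) = Sech y₀ y₁ β (r : ℂ) := by
  have h1 := tendsto_outerExp_Sech hα hX r
  have h2 := tendsto_outerExp_Sech hβ hY r
  simp_rw [← h] at h2
  -- Real points lie in the closure of the open half plane, so limits along this filter are unique.
  have : (𝓝[{σ : ℂ | 0 < σ.im}] (r : ℂ)).NeBot := by
    rw [← mem_closure_iff_nhdsWithin_neBot, Complex.closure_setOfPred_lt_im]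
    simp
  exact tendsto_nhds_unique h1 h2

lemma isTransmissionData_eq_of_isPowerSpectrum {y₀ y₁ : ℝ} {β : ℝ → ℝ}
    (hXY : y₁ - y₀ = x₁ - x₀) (hβ : IntegrableOn β (Ioo y₀ y₁)) {τ τ' : 𝓢'(ℝ, ℂ)} {P : ℝ → ℝ}
    (h : IsTransmissionData x₀ x₁ α τ) (h' : IsTransmissionData y₀ y₁ β τ')
    (hP : IsPowerSpectrum τ P) (hP' : IsPowerSpectrum τ' P) : τ = τ' := by
  have hY : y₀ ≤ y₁ := by linarith
  -- Equal thickness makes the phase factors agree; the `Sech` factors agree by the outer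
  -- representation.
  have hT : transmission x₀ x₁ α = transmission y₀ y₁ β := by
    ext s
    have hXY' : (y₁ - y₀ : ℂ) = x₁ - x₀ := by exact_mod_cast hXY
    rw [transmission, transmission, hXY', Sech_ofReal_eq_of_norm_eq hα hX hβ hY
      (norm_Sech_eq_of_isPowerSpectrum hα hX hβ hY h h' hP hP') s]
  have k1 := (isTransmissionData_iff hα hX τ).1 h
  have k2 := (isTransmissionData_iff hβ hY τ').1 h'
  rw [← hT] at k2
  exact k1.unique k2

end Secant

end HarmonicExp

end

theorem mainTheorem3 (x₀ x₁ : ℝ) (hX : x₀ < x₁) (α : ℝ → ℝ)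
    (hα : IntegrableOn α (Ioo x₀ x₁)) :
    -- `Sech` is well defined, holomorphic and bounded on the closed upper half plane, and outer
    (∀ σ : ℂ, 0 ≤ σ.im → HarmonicExp.Cosh x₀ x₁ α σ ≠ 0) ∧
    AnalyticOnNhd ℂ (HarmonicExp.Sech x₀ x₁ α) {σ : ℂ | 0 ≤ σ.im} ∧
    (∃ C : ℝ, ∀ σ : ℂ, 0 ≤ σ.im → ‖HarmonicExp.Sech x₀ x₁ α σ‖ ≤ C) ∧
    HarmonicExp.IsOuter (HarmonicExp.Sech x₀ x₁ α) ∧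
    -- the representation formula, for `Im σ > 0` and, as a boundary value, for real `σ`
    Integrable (fun s : ℝ => Real.log ‖HarmonicExp.Sech x₀ x₁ α (s : ℂ)‖ / (1 + s ^ 2)) ∧
    (∀ σ : ℂ, 0 < σ.im → HarmonicExp.Sech x₀ x₁ α σ =
      HarmonicExp.outerExp (fun s : ℝ => Real.log ‖HarmonicExp.Sech x₀ x₁ α (s : ℂ)‖) σ) ∧
    (∀ r : ℝ, Tendsto
      (HarmonicExp.outerExp (fun s : ℝ => Real.log ‖HarmonicExp.Sech x₀ x₁ α (s : ℂ)‖))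
      (𝓝[{σ : ℂ | 0 < σ.im}] (r : ℂ)) (𝓝 (HarmonicExp.Sech x₀ x₁ α (r : ℂ)))) ∧
    -- the transmission data exist, are unique, and have the stated Fourier transform
    (∀ (s : ℝ) (T : ℂ), HarmonicExp.IsTransmittedAmplitude x₀ x₁ α s T ↔
      T = Complex.exp (Complex.I * (x₁ - x₀) * s) * HarmonicExp.Sech x₀ x₁ α (s : ℂ)) ∧
    (∃! τ : 𝓢'(ℝ, ℂ), HarmonicExp.IsTransmissionData x₀ x₁ α τ) ∧
    (∀ τ : 𝓢'(ℝ, ℂ), HarmonicExp.IsTransmissionData x₀ x₁ α τ →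
      HarmonicExp.IsPowerSpectrum τ
        (fun s : ℝ => ‖HarmonicExp.Sech x₀ x₁ α (s : ℂ)‖ ^ 2)) ∧
    -- for layers of the same thickness, the power spectrum determines the transmission data
    (∀ (y₀ y₁ : ℝ) (β : ℝ → ℝ), y₁ - y₀ = x₁ - x₀ → IntegrableOn β (Ioo y₀ y₁) →
      ∀ (τ τ' : 𝓢'(ℝ, ℂ)) (P : ℝ → ℝ),
        HarmonicExp.IsTransmissionData x₀ x₁ α τ →
        HarmonicExp.IsTransmissionData y₀ y₁ β τ' →
        HarmonicExp.IsPowerSpectrum τ P → HarmonicExp.IsPowerSpectrum τ' P → τ = τ') := by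
  have hX' := hX.le
  refine ⟨fun σ hσ => HarmonicExp.Cosh_ne_zero hα hX' hσ, HarmonicExp.analyticOnNhd_Sech hα hX',
    ⟨1, fun σ hσ => HarmonicExp.norm_Sech_le_one hα hX' hσ⟩,
    ⟨1, _, norm_one, HarmonicExp.integrable_log_norm_Sech hα hX', fun σ hσ => ?_⟩,
    HarmonicExp.integrable_log_norm_Sech hα hX',
    fun σ hσ => HarmonicExp.Sech_eq_outerExp hα hX' hσ,
    HarmonicExp.tendsto_outerExp_Sech hα hX',
    HarmonicExp.isTransmittedAmplitude_iff_of_integrableOn hα hX',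
    HarmonicExp.existsUnique_isTransmissionData hα hX',
    fun τ h => HarmonicExp.isPowerSpectrum_of_isTransmissionData hα hX' h,
    fun y₀ y₁ β hXY hβ τ τ' P h h' hP hP' =>
      HarmonicExp.isTransmissionData_eq_of_isPowerSpectrum hα hX' hXY hβ h h' hP hP'⟩
  rw [one_mul]
  exact HarmonicExp.Sech_eq_outerExp hα hX' hσ
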